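/- For a finite compactly supported Borel measure $\mu$ on $\mathbb C$ let $p_\mu(z)=\int\log|z-w|\,d\mu(w)$ be its potential and $I(\mu)=\int p_\mu\,d\mu\in[-\infty,\infty)$ its energy. A compact set $K\subset\mathbb C$ is non-polar if $I(\mu)>-\infty$ for some non-zero finite Borel measure $\mu$ on $K$; its equilibrium measure $\omega$ is then the Borel probability measure on $K$ of maximal energy. It is polynomially convex if every $z\in\mathbb C$ with $|p(z)|\le\sup_K|p|$ for all polynomials $p$ lies in $K$. Let $(q_k)_k$ be a sequence of non-constant complex polynomials whose degrees $n_k$ tend to $\infty$, and let $\mu_k=\frac1{n_k}\sum_{j}\delta_{z_{k,j}}$ be the root distribution of $q_k$, where $z_{k,1},\dots,z_{k,n_k}$ are the roots of $q_k$ repeated with multiplicity. The sequence weakly centers on a compact set $C$ if there are $N$ and $R>0$ such that all roots of $q_k$ lie in $\{|z|<R\}$ for all $k\ge N$, and $\mu_k(L)\to0$ for every closed set $L$ with $L\cap C=\emptyset$. For $K$ compact, non-polar and polynomially convex, with Green's function $g_\Omega=p_\omega-I(\omega)$ of $\Omega=\mathbb C\setminus K$ with pole at $\infty$, the sequence is $K$-regular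 if, for some $R>0$, $\frac1{n_k}\log|q_k(z)|\to g_\Omega(z)$ as $k\to\infty$, uniformly on $\{|z|\ge R\}$. **Theorem.** Let $K\subset\mathbb C$ be compact, non-polar and polynomially convex, and let $\omega$ be its equilibrium measure. Suppose that $\omega(\overline V)=0$ for every connected component $V$ of the interior of $K$. If $(q_k)$ is $K$-regular and weakly centers on $K$, then $(q_k)$ weakly centers on $J=\partial K$, and $\mu_k\to\omega$ in the weak-$*$ topology. -/

import Mathlib

open MeasureTheory Filter Topology Polynomial
open scoped ENNReal

namespace PlanarPotential

noncomputable section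

/-- The integral of an extended real function, as an extended real number:
the integral of the positive part minus the integral of the negative part. -/
def extIntegral (μ : Measure ℂ) (f : ℂ → EReal) : EReal :=
  ((∫⁻ w, (f w).toENNReal ∂μ : ℝ≥0∞) : EReal) - ((∫⁻ w, (-f w).toENNReal ∂μ : ℝ≥0∞) : EReal)

/-- The logarithmic potential `p_μ(z) = ∫ log |z - w| dμ(w)`. Here `ENNReal.log` is the
logarithm with values in `[-∞, ∞]`, so that `log 0 = -∞`. -/
def potential (μ : Measure ℂ) (z : ℂ) : EReal :=
  extIntegral μ (fun w => ENNReal.log ‖z - w‖ₑ)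

/-- The energy `I(μ) = ∬ log |z - w| dμ(w) dμ(z)`. -/
def energy (μ : Measure ℂ) : EReal :=
  extIntegral μ (potential μ)

/-- A set is polar if every nonzero finite Borel measure with compact support in it has
energy `-∞`. -/
def IsPolar (E : Set ℂ) : Prop :=
  ∀ μ : Measure ℂ, IsFiniteMeasure μ → μ ≠ 0 →
    (∃ C : Set ℂ, IsCompact C ∧ C ⊆ E ∧ μ Cᶜ = 0) → energy μ = ⊥

/-- `ω` is an equilibrium measure of the compact set `K`: it is a Borel probability measure
on `K` and has maximal energy among those. -/
structure IsEquilibriumMeasure (K : Set ℂ) (ω : Measure ℂ) : Prop where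
  prob : IsProbabilityMeasure ω
  supported : ω Kᶜ = 0
  maximal : ∀ μ : Measure ℂ, IsProbabilityMeasure μ → μ Kᶜ = 0 → energy μ ≤ energy ω

open Classical in
/-- The equilibrium measure of `K` (which exists and is unique for `K` compact and non-polar). -/
def equilibriumMeasure (K : Set ℂ) : Measure ℂ :=
  if h : ∃ ω : Measure ℂ, IsEquilibriumMeasure K ω then h.choose else 0

instance (K : Set ℂ) : IsFiniteMeasure (equilibriumMeasure K) := by
  unfold equilibriumMeasure
  split_ifs with h
  · have := h.choose_spec.prob
    infer_instance
  · infer_instance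

/-- The Green function `p_ω - I(ω)` with pole at infinity of the complement of `K`, where `ω` is
the equilibrium measure of `K`. For `K` compact and non-polar, `I(ω)` is finite, and so is `p_ω`
at every point, since `I(ω) ≤ p_ω`. -/
def greenFunction (K : Set ℂ) (z : ℂ) : ℝ :=
  (potential (equilibriumMeasure K) z - energy (equilibriumMeasure K)).toReal

/-- `K` contains its polynomial hull: every `z` with `|p(z)| ≤ sup_K |p|` for all polynomials `p`
lies in `K`. -/
def IsPolynomiallyConvex (K : Set ℂ) : Prop :=
  ∀ z : ℂ, (∀ (p : ℂ[X]) (M : ℝ), (∀ w ∈ K, ‖p.eval w‖ ≤ M) → ‖p.eval z‖ ≤ M) → z ∈ K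

/-- The root distribution of a nonconstant polynomial `q` of degree `n`:
`1 / n` times the sum of the point masses at the roots, repeated with multiplicity. -/
def rootDistribution (q : ℂ[X]) : Measure ℂ :=
  (q.natDegree : ℝ≥0∞)⁻¹ • (q.roots.map fun z => Measure.dirac z).sum

lemma rootDistribution_univ_le (q : ℂ[X]) : rootDistribution q Set.univ ≤ 1 := by
  have key : ∀ s : Multiset ℂ,
      (s.map fun z => (Measure.dirac z : Measure ℂ)).sum Set.univ = Multiset.card s := by
    intro s
    induction s using Multiset.induction_on with
    | empty => simp
    | cons a s ih => simp [ih, add_comm]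
  simp only [rootDistribution, Measure.smul_apply, key, smul_eq_mul]
  calc (q.natDegree : ℝ≥0∞)⁻¹ * (Multiset.card q.roots : ℝ≥0∞)
      ≤ (q.natDegree : ℝ≥0∞)⁻¹ * (q.natDegree : ℝ≥0∞) := by
        gcongr
        exact q.card_roots'
    _ ≤ 1 := ENNReal.inv_mul_le_one _

instance (q : ℂ[X]) : IsFiniteMeasure (rootDistribution q) :=
  ⟨(rootDistribution_univ_le q).trans_lt ENNReal.one_lt_top⟩

/-- The sequence `(q_k)` weakly centers on the set `C`. -/
def WeaklyCentersOn (q : ℕ → ℂ[X]) (C : Set ℂ) : Prop :=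
  (∃ N : ℕ, ∃ R : ℝ, 0 < R ∧ ∀ k ≥ N, ∀ z : ℂ, (q k).eval z = 0 → ‖z‖ < R) ∧
  ∀ L : Set ℂ, IsClosed L → Disjoint L C →
    Tendsto (fun k => rootDistribution (q k) L) atTop (𝓝 0)

/-- The sequence `(q_k)` is `K`-regular: for some `R > 0`, `(1 / n_k) log |q_k|` converges to the
Green function of the complement of `K`, uniformly outside the disc of radius `R` about `0`.
(The convention `Real.log 0 = 0` has no influence: if a nonconstant `q_k` had a root in that
region, then `log |q_k|` would be unbounded below at nearby points of the region, where the
Green function is nonnegative.) -/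
def IsKRegular (K : Set ℂ) (q : ℕ → ℂ[X]) : Prop :=
  ∃ R : ℝ, 0 < R ∧
    TendstoUniformlyOn (fun k z => (1 / ((q k).natDegree : ℝ)) * Real.log ‖(q k).eval z‖)
      (greenFunction K) atTop {z : ℂ | R ≤ ‖z‖}

end

end PlanarPotential

open PlanarPotential

/-! All roots eventually lie in a fixed disc, so the root distributions have weak limits along
ultrafilters, and it suffices to identify every limit $\nu$ with $\omega$. Weak centering puts $\nu$
on $K$. Since $\frac1{n_k}\log|q_k|$ is the potential of $\mu_k$ plus a term from the leading
coefficient that does not depend on $z$, regularity makes $p_\omega-p_\nu$ constant near infinity.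
Both potentials are $\log|z|+o(1)$, so $p_\nu=p_\omega$ there
(`exists_realPotential_eq_of_isKRegular`).

This alone does not exclude mass of $\nu$ inside $K$. For a component $V$ of the interior, sweep
$\nu|_V$ onto $\partial V$ and the rest of $\nu$ onto $\partial K$ without changing the potential
near infinity (`exists_sweep`: maximum principle, Hahn–Banach, Riesz). The sum $\sigma$ lives on
$\partial K$ and must equal $\omega$, by the next paragraph. Hence $\nu(V)\le\omega(\overline V)=0$;
so $\nu$ itself lives on $\partial K$, and the same uniqueness gives $\nu=\omega$
(`eq_equilibriumMeasure_of_components_null`).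

Uniqueness (`eq_equilibriumMeasure_of_realPotential_eq`): polynomial convexity makes $\mathbb
C\setminus K$ connected, so $p_\sigma=p_\omega$ off $K$, and $p_\omega\ge I(\omega)$ there by
Frostman (`le_realPotential_of_minimal`). Upper semicontinuity of $p_\sigma$ carries the bound to
$\partial K$; integrating against $\sigma$ gives $I(\sigma)\ge I(\omega)$. A measure of maximal
energy is unique because the logarithmic energy is strictly positive definite
(`eq_of_logEnergy_add_le`), shown by writing the logarithm as a superposition of Gaussians. -/

namespace PlanarPotential

noncomputable section

/-! ### Extended integrals and the nonnegative logarithmic kernel. -/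

section

/-- The integral of a constant minus a nonnegative function. -/
lemma extIntegral_const_sub {μ : Measure ℂ} [IsFiniteMeasure μ] {f : ℂ → EReal} {c : ℝ}
    {h : ℂ → ℝ≥0∞} (hh : Measurable h) (hf : ∀ᵐ w ∂μ, f w = (c : EReal) - (h w : EReal)) :
    extIntegral μ f = ((c * μ.real Set.univ : ℝ) : EReal) - ((∫⁻ w, h w ∂μ : ℝ≥0∞) : EReal) := by
  have hp : ∫⁻ w, (f w).toENNReal ∂μ = ∫⁻ w, (ENNReal.ofReal c - h w) ∂μ := by
    refine lintegral_congr_ae ?_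
    filter_upwards [hf] with w hw
    rw [hw]
    rcases eq_or_ne (h w) ⊤ with ht | ht
    · simp [ht]
    · lift h w to NNReal using ht with a ha
      have h1 : ((a : ℝ≥0∞) : EReal) = ((a : ℝ) : EReal) := rfl
      rw [h1, ← EReal.coe_sub, EReal.toENNReal_of_ne_top (EReal.coe_ne_top _), EReal.toReal_coe,
        ENNReal.ofReal_sub _ a.coe_nonneg, ENNReal.ofReal_coe_nnreal]
  -- This is the integrated form of $(h-c)^++c^+=(c-h)^++h+c^-$, arranged without subtraction so
  -- that it survives $h=\infty$.
  have hn : ∫⁻ w, (-f w).toENNReal ∂μ + ENNReal.ofReal c * μ Set.univ =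
      ∫⁻ w, (ENNReal.ofReal c - h w) ∂μ + ∫⁻ w, h w ∂μ + ENNReal.ofReal (-c) * μ Set.univ := by
    rw [← lintegral_const, ← lintegral_const, ← lintegral_add_right _ measurable_const,
      ← lintegral_add_right _ hh, ← lintegral_add_right _ measurable_const]
    refine lintegral_congr_ae ?_
    filter_upwards [hf] with w hw
    rw [hw]
    rcases eq_or_ne (h w) ⊤ with ht | ht
    · simp [ht]
    · lift h w to NNReal using ht with a ha
      have h1 : ((a : ℝ≥0∞) : EReal) = ((a : ℝ) : EReal) := rfl
      rw [h1, ← EReal.coe_sub, ← EReal.coe_neg, EReal.toENNReal_of_ne_top (EReal.coe_ne_top _),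
        EReal.toReal_coe, ← ENNReal.ofReal_coe_nnreal, ← ENNReal.ofReal_sub _ a.coe_nonneg,
        ENNReal.ofReal, ENNReal.ofReal, ENNReal.ofReal, ENNReal.ofReal, ENNReal.ofReal]
      norm_cast
      ext
      push_cast
      simp only [Real.coe_toNNReal']
      have := a.coe_nonneg
      grind
  rw [extIntegral, hp]
  have hpf : ∫⁻ w, (ENNReal.ofReal c - h w) ∂μ ≠ ⊤ := by
    refine ne_top_of_le_ne_top ?_ (lintegral_mono fun w => tsub_le_self (b := h w))
    rw [lintegral_const]
    exact ENNReal.mul_ne_top ENNReal.ofReal_ne_top (measure_ne_top _ _)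
  have hc1 : ENNReal.ofReal c * μ Set.univ ≠ ⊤ :=
    ENNReal.mul_ne_top ENNReal.ofReal_ne_top (measure_ne_top _ _)
  have hc2 : ENNReal.ofReal (-c) * μ Set.univ ≠ ⊤ :=
    ENNReal.mul_ne_top ENNReal.ofReal_ne_top (measure_ne_top _ _)
  generalize ∫⁻ w, (ENNReal.ofReal c - h w) ∂μ = A at *
  generalize ∫⁻ w, h w ∂μ = H at *
  generalize ∫⁻ w, (-f w).toENNReal ∂μ = B at *
  have hcm : c * μ.real Set.univ =
      (ENNReal.ofReal c * μ Set.univ).toReal - (ENNReal.ofReal (-c) * μ Set.univ).toReal := by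
    rw [ENNReal.toReal_mul, ENNReal.toReal_mul, ← sub_mul, ENNReal.toReal_ofReal',
      ENNReal.toReal_ofReal', Measure.real]
    congr 1
    grind
  rcases eq_or_ne H ⊤ with rfl | hH
  · have : B = ⊤ := by
      simp only [add_top, top_add, ENNReal.add_eq_top, hc1, or_false] at hn
      exact hn
    subst this
    simp
  · have hB : B ≠ ⊤ := by
      intro h
      rw [h, top_add] at hn
      exact (ENNReal.add_ne_top.2 ⟨ENNReal.add_ne_top.2 ⟨hpf, hH⟩, hc2⟩) hn.symm
    have := congrArg ENNReal.toReal hn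
    rw [ENNReal.toReal_add hB hc1, ENNReal.toReal_add (ENNReal.add_ne_top.2 ⟨hpf, hH⟩) hc2,
      ENNReal.toReal_add hpf hH] at this
    rw [hcm]
    have e : ∀ x : ℝ≥0∞, x ≠ ⊤ → (x : EReal) = ((x.toReal : ℝ) : EReal) := fun x hx =>
      (EReal.coe_ennreal_toReal hx).symm
    rw [e A hpf, e B hB, e H hH, ← EReal.coe_sub, ← EReal.coe_sub]
    congr 1
    linarith

/-- The logarithmic kernel `log (b / |z - w|)`, truncated at `0`. -/
def logKernel (b : ℝ) (z w : ℂ) : ℝ≥0∞ :=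
  (ENNReal.log (ENNReal.ofReal b * ‖z - w‖ₑ⁻¹)).toENNReal

/-- The integral of the logarithmic kernel. -/
def logPot (b : ℝ) (μ : Measure ℂ) (z : ℂ) : ℝ≥0∞ := ∫⁻ w, logKernel b z w ∂μ

/-- The mutual energy of two measures with respect to the logarithmic kernel. -/
def logEnergy (b : ℝ) (μ ν : Measure ℂ) : ℝ≥0∞ := ∫⁻ z, logPot b ν z ∂μ

/-- The logarithmic potential as a real integral. -/
def realPotential (μ : Measure ℂ) (z : ℂ) : ℝ := ∫ w, Real.log ‖z - w‖ ∂μ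

variable {b : ℝ} {z w : ℂ}

lemma logKernel_self (hb : 0 < b) (z : ℂ) : logKernel b z z = ⊤ := by
  simp [logKernel, ENNReal.mul_top, hb]

lemma logKernel_of_ne (hb : 0 < b) (h : z ≠ w) :
    logKernel b z w = ENNReal.ofReal (Real.log b - Real.log ‖z - w‖) := by
  have hn : 0 < ‖z - w‖ := norm_pos_iff.2 (sub_ne_zero.2 h)
  rw [logKernel, ← ofReal_norm, ← ENNReal.ofReal_inv_of_pos hn,
    ← ENNReal.ofReal_mul hb.le, ENNReal.log_ofReal_of_pos (by positivity),
    EReal.toENNReal_of_ne_top (EReal.coe_ne_top _), EReal.toReal_coe,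
    Real.log_mul hb.ne' (by positivity), Real.log_inv, ← sub_eq_add_neg]

lemma logKernel_comm (b : ℝ) (z w : ℂ) : logKernel b z w = logKernel b w z := by
  rw [logKernel, logKernel, ← ofReal_norm, ← ofReal_norm, norm_sub_rev]

/-- With values in $[0,\infty]$ the kernel is continuous even across the diagonal; measurability and
all semicontinuity statements below come from this. -/
lemma continuous_logKernel (b : ℝ) : Continuous fun p : ℂ × ℂ => logKernel b p.1 p.2 := by
  refine EReal.continuous_toENNReal.comp (ENNReal.continuous_log.comp ?_)
  exact (ENNReal.continuous_const_mul ENNReal.ofReal_ne_top).comp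
    (continuous_inv.comp (by fun_prop))

@[fun_prop]
lemma measurable_logKernel (b : ℝ) : Measurable fun p : ℂ × ℂ => logKernel b p.1 p.2 :=
  (continuous_logKernel b).measurable

lemma measurable_logKernel_left (b : ℝ) (z : ℂ) : Measurable fun w => logKernel b z w :=
  Measurable.of_uncurry_left (f := logKernel b) (measurable_logKernel b)

lemma measurable_logPot (b : ℝ) (μ : Measure ℂ) [SFinite μ] : Measurable (logPot b μ) :=
  (measurable_logKernel b).lintegral_prod_right'

lemma log_eq_sub_logKernel (hb : 0 < b) (h : ‖z - w‖ ≤ b) :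
    ENNReal.log ‖z - w‖ₑ = (Real.log b : EReal) - (logKernel b z w : EReal) := by
  rcases eq_or_ne z w with rfl | hne
  · simp [logKernel_self hb]
  · have hn : 0 < ‖z - w‖ := norm_pos_iff.2 (sub_ne_zero.2 hne)
    rw [logKernel_of_ne hb hne, EReal.coe_ennreal_ofReal, ← ofReal_norm,
      ENNReal.log_ofReal_of_pos hn, ← EReal.coe_sub, max_eq_left, sub_sub_cancel]
    exact sub_nonneg.2 (Real.log_le_log hn h)

/-- Because $\log(1+s)\le s$. In the continuity principle, $\zeta$ is a point of the support nearest
to $z$. -/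
lemma logKernel_le_add (hb : 0 < b) {ζ : ℂ} {s : ℝ} (hs : 0 ≤ s)
    (h : ‖ζ - w‖ ≤ (1 + s) * ‖z - w‖) :
    logKernel b z w ≤ logKernel b ζ w + ENNReal.ofReal s := by
  rcases eq_or_ne ζ w with rfl | hζ
  · simp [logKernel_self hb]
  have hζ' : 0 < ‖ζ - w‖ := norm_pos_iff.2 (sub_ne_zero.2 hζ)
  have hz' : 0 < ‖z - w‖ := by
    by_contra hc
    have : ‖z - w‖ = 0 := le_antisymm (not_lt.1 hc) (norm_nonneg _)
    rw [this, mul_zero] at h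
    linarith
  have hz : z ≠ w := by
    rintro rfl
    simp at hz'
  rw [logKernel_of_ne hb hz, logKernel_of_ne hb hζ]
  refine le_trans (ENNReal.ofReal_le_ofReal ?_) ENNReal.ofReal_add_le
  have h1 := Real.log_le_log hζ' h
  rw [Real.log_mul (by positivity) hz'.ne'] at h1
  have h2 := Real.log_le_sub_one_of_pos (show 0 < 1 + s by positivity)
  linarith

/-- When $b$ bounds all distances involved, the truncation in the kernel is inactive. Maximizing
`energy` thereby becomes minimizing the $[0,\infty]$-valued `logEnergy`. -/
lemma potential_eq (hb : 0 < b) {μ : Measure ℂ} [IsFiniteMeasure μ]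
    (h : ∀ᵐ w ∂μ, ‖z - w‖ ≤ b) :
    potential μ z = ((Real.log b * μ.real Set.univ : ℝ) : EReal) - (logPot b μ z : EReal) := by
  refine extIntegral_const_sub (measurable_logKernel_left b z) ?_
  filter_upwards [h] with w hw using log_eq_sub_logKernel hb hw

lemma energy_eq (hb : 0 < b) {μ : Measure ℂ} [IsFiniteMeasure μ]
    (h : ∀ᵐ z ∂μ, ∀ᵐ w ∂μ, ‖z - w‖ ≤ b) :
    energy μ = ((Real.log b * μ.real Set.univ * μ.real Set.univ : ℝ) : EReal) -
      (logEnergy b μ μ : EReal) := by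
  refine extIntegral_const_sub (measurable_logPot b μ) ?_
  filter_upwards [h] with z hz using potential_eq hb hz

lemma logEnergy_comm (b : ℝ) (μ ν : Measure ℂ) [SFinite μ] [SFinite ν] :
    logEnergy b μ ν = logEnergy b ν μ := by
  unfold logEnergy logPot
  rw [lintegral_lintegral_swap (measurable_logKernel b).aemeasurable]
  simp_rw [logKernel_comm b]

lemma logPot_add (b : ℝ) (μ ν : Measure ℂ) (z : ℂ) :
    logPot b (μ + ν) z = logPot b μ z + logPot b ν z := lintegral_add_measure _ _ _

lemma logPot_smul (b : ℝ) (c : ℝ≥0∞) (μ : Measure ℂ) (z : ℂ) :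
    logPot b (c • μ) z = c * logPot b μ z := lintegral_smul_measure _ _

lemma logEnergy_add_left (b : ℝ) (μ ν σ : Measure ℂ) :
    logEnergy b (μ + ν) σ = logEnergy b μ σ + logEnergy b ν σ := lintegral_add_measure _ _ _

lemma logEnergy_smul_left (b : ℝ) (c : ℝ≥0∞) (μ σ : Measure ℂ) :
    logEnergy b (c • μ) σ = c * logEnergy b μ σ := lintegral_smul_measure _ _

lemma logEnergy_add_right (b : ℝ) (μ ν σ : Measure ℂ) [SFinite μ] [SFinite ν] :
    logEnergy b σ (μ + ν) = logEnergy b σ μ + logEnergy b σ ν := by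
  simp only [logEnergy, logPot_add]
  exact lintegral_add_left (measurable_logPot b μ) _

lemma logEnergy_smul_right (b : ℝ) (c : ℝ≥0∞) (μ σ : Measure ℂ) [SFinite μ] :
    logEnergy b σ (c • μ) = c * logEnergy b σ μ := by
  simp only [logEnergy, logPot_smul]
  exact lintegral_const_mul _ (measurable_logPot b μ)

/-- Fatou's lemma along a sequence tending to $z$ on which the potential stays at most $y$. -/
lemma lowerSemicontinuous_logPot (b : ℝ) (μ : Measure ℂ) : LowerSemicontinuous (logPot b μ) := by
  intro z y hy
  by_contra hcon
  have hf : ∃ᶠ x in 𝓝 z, logPot b μ x ≤ y :=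
    (not_eventually.1 hcon).mono fun x hx => not_lt.1 hx
  obtain ⟨u, hu, hu'⟩ := exists_seq_forall_of_frequently hf
  refine absurd hy (not_lt.2 ?_)
  calc logPot b μ z = ∫⁻ w, liminf (fun n => logKernel b (u n) w) atTop ∂μ := by
        refine lintegral_congr fun w => ?_
        exact (Tendsto.liminf_eq (((continuous_logKernel b).tendsto (z, w)).comp
          (hu.prodMk_nhds tendsto_const_nhds))).symm
    _ ≤ liminf (fun n => ∫⁻ w, logKernel b (u n) w ∂μ) atTop :=
        lintegral_liminf_le fun n => measurable_logKernel_left b (u n)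
    _ ≤ y := by
        refine liminf_le_of_frequently_le' (Frequently.of_forall fun n => hu' n)

end

/-! ### Strict positive definiteness of the logarithmic energy through Gaussian kernels. -/

section

/-- The mutual Gaussian energy of two measures. -/
def gaussEnergy (t : ℝ) (μ ν : Measure ℂ) : ℝ :=
  ∫ p, Real.exp (-t * ‖p.1 - p.2‖ ^ 2) ∂(μ.prod ν)

open ProbabilityTheory in
-- Full support is what turns an almost everywhere equality of continuous characteristic functions
-- into equality everywhere.
instance isOpenPosMeasure_stdGaussian : (stdGaussian ℂ).IsOpenPosMeasure := by
  unfold stdGaussian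
  have : (gaussianReal 0 1).IsOpenPosMeasure :=
    (gaussianReal_absolutelyContinuous' 0 one_ne_zero).isOpenPosMeasure
  refine Continuous.isOpenPosMeasure_map (by fun_prop) fun x => ?_
  exact ⟨fun i => (stdOrthonormalBasis ℝ ℂ).repr x i, (stdOrthonormalBasis ℝ ℂ).sum_repr x⟩

open ProbabilityTheory ComplexConjugate in
-- The kernel $e^{-s^2|v|^2/2}$ is itself the characteristic function of the standard Gaussian at
-- $sv$; Fubini does the rest.
lemma gaussEnergy_eq_integral_charFun (μ ν : Measure ℂ) [IsFiniteMeasure μ] [IsFiniteMeasure ν]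
    (s : ℝ) :
    ((gaussEnergy (s ^ 2 / 2) μ ν : ℝ) : ℂ) =
      ∫ x, charFun μ (s • x) * conj (charFun ν (s • x)) ∂(stdGaussian ℂ) := by
  have h1 : ∀ x : ℂ, charFun μ (s • x) * conj (charFun ν (s • x)) =
      ∫ p, Complex.exp (inner ℝ (p.1 - p.2) (s • x) * Complex.I) ∂(μ.prod ν) := by
    intro x
    rw [charFun_apply, charFun_apply, ← integral_conj, ← integral_prod_mul]
    refine integral_congr_ae (ae_of_all _ fun p => ?_)
    simp only
    rw [← Complex.exp_conj, ← Complex.exp_add, inner_sub_left]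
    simp only [map_mul, Complex.conj_ofReal, Complex.conj_I]
    push_cast
    ring_nf
  simp_rw [h1]
  rw [integral_integral_swap]
  · rw [gaussEnergy, ← integral_complex_ofReal]
    refine integral_congr_ae (ae_of_all _ fun p => ?_)
    simp only
    have h2 : ∀ x : ℂ, inner ℝ (p.1 - p.2) (s • x) = inner ℝ x (s • (p.1 - p.2)) := by
      intro x
      rw [real_inner_smul_right, real_inner_smul_right, real_inner_comm]
    simp_rw [h2]
    rw [← charFun_apply, charFun_stdGaussian, norm_smul, Complex.ofReal_mul, mul_pow,
      ← Complex.ofReal_pow, Real.norm_eq_abs, sq_abs]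
    push_cast
    congr 1
    ring
  · refine Integrable.of_bound (C := 1) ?_ (ae_of_all _ fun p => ?_)
    · refine Continuous.aestronglyMeasurable ?_
      simp only [Function.uncurry_def]
      fun_prop
    · simp only [Function.uncurry_def]
      rw [Complex.norm_exp_ofReal_mul_I]

open ProbabilityTheory ComplexConjugate in
lemma integrable_charFun_mul (μ ν : Measure ℂ) [IsFiniteMeasure μ] [IsFiniteMeasure ν] (s : ℝ) :
    Integrable (fun x => charFun μ (s • x) * conj (charFun ν (s • x))) (stdGaussian ℂ) := by
  have hs : Measurable fun x : ℂ => s • x := by fun_prop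
  refine Integrable.of_bound (C := μ.real Set.univ * ν.real Set.univ) ?_ (ae_of_all _ fun p => ?_)
  · refine Measurable.aestronglyMeasurable ?_
    exact (measurable_charFun.comp hs).mul
      (Complex.continuous_conj.measurable.comp (measurable_charFun.comp hs))
  · rw [norm_mul, RCLike.norm_conj]
    gcongr <;> exact norm_charFun_le _

lemma continuous_charFun_complex (μ : Measure ℂ) [IsFiniteMeasure μ] : Continuous (charFun μ) := by
  have : charFun μ = fun t => ∫ x, Complex.exp (inner ℝ x t * Complex.I) ∂μ := by
    ext t; rw [charFun_apply]
  rw [this]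
  refine continuous_of_dominated (bound := fun _ => 1) (fun t => ?_) (fun t => ?_)
    (integrable_const _) ?_
  · exact Continuous.aestronglyMeasurable (by fun_prop)
  · exact ae_of_all _ fun x => (Complex.norm_exp_ofReal_mul_I _).le
  · exact ae_of_all _ fun x => by fun_prop

open ProbabilityTheory ComplexConjugate in
/-- The Gaussian energy of a difference of measures, through characteristic functions. -/
lemma gaussEnergy_sub (μ ν : Measure ℂ) [IsFiniteMeasure μ] [IsFiniteMeasure ν] (s : ℝ) :
    gaussEnergy (s ^ 2 / 2) μ μ + gaussEnergy (s ^ 2 / 2) ν ν - 2 * gaussEnergy (s ^ 2 / 2) μ ν =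
      ∫ x, ‖charFun μ (s • x) - charFun ν (s • x)‖ ^ 2 ∂(stdGaussian ℂ) := by
  have h : ∀ α β : Measure ℂ, IsFiniteMeasure α → IsFiniteMeasure β →
      gaussEnergy (s ^ 2 / 2) α β =
        ∫ x, (charFun α (s • x) * conj (charFun β (s • x))).re ∂(stdGaussian ℂ) := by
    intro α β _ _
    have := congrArg Complex.re (gaussEnergy_eq_integral_charFun α β s)
    rw [Complex.ofReal_re] at this
    rw [this]
    exact (integral_re (integrable_charFun_mul α β s)).symm
  have hi : ∀ α β : Measure ℂ, IsFiniteMeasure α → IsFiniteMeasure β →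
      Integrable (fun x => (charFun α (s • x) * conj (charFun β (s • x))).re) (stdGaussian ℂ) :=
    fun α β _ _ => (integrable_charFun_mul α β s).re
  rw [h μ μ, h ν ν, h μ ν, ← integral_add, ← integral_const_mul, ← integral_sub]
  rotate_left
  · exact (hi μ μ ‹_› ‹_›).add (hi ν ν ‹_› ‹_›)
  · exact (hi μ ν ‹_› ‹_›).const_mul 2
  · exact hi μ μ ‹_› ‹_›
  · exact hi ν ν ‹_› ‹_›
  all_goals try infer_instance
  refine integral_congr_ae (ae_of_all _ fun x => ?_)
  simp only
  rw [← Complex.normSq_eq_norm_sq, Complex.normSq_apply]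
  simp only [Complex.mul_re, Complex.conj_re, Complex.conj_im, Complex.sub_re, Complex.sub_im]
  ring

lemma two_mul_gaussEnergy_le {t : ℝ} (ht : 0 ≤ t) (μ ν : Measure ℂ) [IsFiniteMeasure μ]
    [IsFiniteMeasure ν] :
    2 * gaussEnergy t μ ν ≤ gaussEnergy t μ μ + gaussEnergy t ν ν := by
  -- With $s=\sqrt{2t}$ the exponent $s^2/2$ equals $t$.
  have h := gaussEnergy_sub μ ν (Real.sqrt (2 * t))
  rw [Real.sq_sqrt (by positivity), mul_div_cancel_left₀ _ two_ne_zero] at h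
  rw [← sub_nonneg, h]
  exact integral_nonneg fun x => by positivity

open ProbabilityTheory in
/-- The Gaussian energy is strictly positive definite. -/
lemma eq_of_gaussEnergy {t : ℝ} (ht : 0 < t) (μ ν : Measure ℂ) [IsFiniteMeasure μ]
    [IsFiniteMeasure ν] (h : gaussEnergy t μ μ + gaussEnergy t ν ν ≤ 2 * gaussEnergy t μ ν) :
    μ = ν := by
  have hs := gaussEnergy_sub μ ν (Real.sqrt (2 * t))
  rw [Real.sq_sqrt (by positivity), mul_div_cancel_left₀ _ two_ne_zero] at hs
  set s := Real.sqrt (2 * t) with hsdef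
  have hs0 : s ≠ 0 := (Real.sqrt_pos.2 (by positivity)).ne'
  have hcont : Continuous fun x : ℂ => ‖charFun μ (s • x) - charFun ν (s • x)‖ ^ 2 := by
    have h1 := continuous_charFun_complex μ
    have h2 := continuous_charFun_complex ν
    fun_prop
  have hint : Integrable (fun x : ℂ => ‖charFun μ (s • x) - charFun ν (s • x)‖ ^ 2)
      (stdGaussian ℂ) := by
    refine Integrable.of_bound (C := (μ.real Set.univ + ν.real Set.univ) ^ 2)
      hcont.aestronglyMeasurable (ae_of_all _ fun x => ?_)
    rw [norm_pow, norm_norm]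
    gcongr
    exact (norm_sub_le _ _).trans (add_le_add (norm_charFun_le _) (norm_charFun_le _))
  have h0 : ∫ x, ‖charFun μ (s • x) - charFun ν (s • x)‖ ^ 2 ∂(stdGaussian ℂ) = 0 := by
    refine le_antisymm ?_ (integral_nonneg fun x => by positivity)
    rw [← hs]
    linarith
  rw [integral_eq_zero_iff_of_nonneg (fun x => by positivity) hint] at h0
  replace h0 := (Continuous.ae_eq_iff_eq _ hcont continuous_zero).1 h0
  refine Measure.ext_of_charFun ?_
  ext x
  have := congrFun h0 (s⁻¹ • x)
  simp only [smul_inv_smul₀ hs0] at this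
  simpa [sub_eq_zero] using this

/-- The integral of `exp (-t r²) / (2 t)` over `t > ε`. -/
def gaussKernel (ε r : ℝ) : ℝ≥0∞ :=
  ∫⁻ t in Set.Ioi ε, ENNReal.ofReal (Real.exp (-t * r ^ 2) / (2 * t))

lemma gaussKernel_ne_top {ε b : ℝ} (hε : 0 < ε) (hb : 0 < b) : gaussKernel ε b ≠ ⊤ := by
  have hi : IntegrableOn (fun t : ℝ => Real.exp (-(b ^ 2) * t) / (2 * ε)) (Set.Ioi ε) :=
    (integrableOn_exp_mul_Ioi (by nlinarith) ε).div_const _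
  refine ne_top_of_le_ne_top (hi.lintegral_lt_top).ne ?_
  refine setLIntegral_mono' measurableSet_Ioi fun t ht => ENNReal.ofReal_le_ofReal ?_
  rw [show -t * b ^ 2 = -(b ^ 2) * t by ring]
  have : ε < t := ht
  gcongr

lemma gaussKernel_zero {ε : ℝ} (hε : 0 < ε) : gaussKernel ε 0 = ⊤ := by
  by_contra h
  refine not_integrableOn_Ioi_inv (a := ε) ?_
  have h1 : IntegrableOn (fun t : ℝ => 1 / (2 * t)) (Set.Ioi ε) := by
    refine ⟨Measurable.aestronglyMeasurable (by fun_prop), ?_⟩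
    rw [hasFiniteIntegral_iff_ofReal]
    · refine lt_top_iff_ne_top.2 ?_
      simpa [gaussKernel] using h
    · refine (ae_restrict_iff' measurableSet_Ioi).2 (ae_of_all _ fun t (ht : ε < t) => ?_)
      have : 0 < t := hε.trans ht
      simp only [Pi.zero_apply]
      positivity
  have h2 := h1.const_mul 2
  refine h2.congr (ae_of_all _ fun t => ?_)
  simp only
  rw [one_div, mul_inv, ← mul_assoc]
  norm_num

/-- Frullani's integral: the integrand is $\int_{r^2}^{b^2}\frac12e^{-tx}\,dx$, and integrating in
$t$ first leaves $\int_{r^2}^{b^2}\frac{dx}{2x}$. -/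
lemma lintegral_exp_sub_exp_div {r b : ℝ} (hr : 0 < r) (hb : r ≤ b) :
    ∫⁻ t in Set.Ioi (0 : ℝ),
      ENNReal.ofReal ((Real.exp (-t * r ^ 2) - Real.exp (-t * b ^ 2)) / (2 * t)) =
    ENNReal.ofReal (Real.log b - Real.log r) := by
  have hb0 : 0 < b := hr.trans_le hb
  have hrb : r ^ 2 ≤ b ^ 2 := by gcongr
  have h1 : ∀ t ∈ Set.Ioi (0 : ℝ),
      ENNReal.ofReal ((Real.exp (-t * r ^ 2) - Real.exp (-t * b ^ 2)) / (2 * t)) =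
      ∫⁻ x in Set.Ioc (r ^ 2) (b ^ 2), ENNReal.ofReal (Real.exp (-t * x) / 2) := by
    intro t ht
    have ht : 0 < t := ht
    have hc : Continuous fun x : ℝ => Real.exp (-t * x) / 2 := by fun_prop
    rw [← ofReal_integral_eq_lintegral_ofReal
      (hc.integrableOn_Icc.mono_set Set.Ioc_subset_Icc_self) (ae_of_all _ fun x => by positivity),
      ← intervalIntegral.integral_of_le hrb,
      intervalIntegral.integral_eq_sub_of_hasDerivAt
        (f := fun x => -(Real.exp (-t * x) / (2 * t))) _ (hc.intervalIntegrable _ _)]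
    · congr 1
      ring
    · intro x _
      have h := (((hasDerivAt_id x).const_mul (-t)).exp.div_const (2 * t)).neg
      refine h.congr_deriv ?_
      simp only [id]
      field_simp
  rw [setLIntegral_congr_fun measurableSet_Ioi h1, lintegral_lintegral_swap (by fun_prop)]
  have h2 : ∀ x ∈ Set.Ioc (r ^ 2) (b ^ 2),
      ∫⁻ t in Set.Ioi (0 : ℝ), ENNReal.ofReal (Real.exp (-t * x) / 2) =
        ENNReal.ofReal (x⁻¹ / 2) := by
    intro x hx
    have hx : 0 < x := (by positivity : 0 < r ^ 2).trans hx.1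
    have hi : IntegrableOn (fun t : ℝ => Real.exp (-x * t) / 2) (Set.Ioi 0) :=
      (integrableOn_exp_mul_Ioi (by linarith) 0).div_const _
    have hc : ∀ t : ℝ, -t * x = -x * t := fun t => by ring
    simp_rw [hc]
    rw [← ofReal_integral_eq_lintegral_ofReal hi (ae_of_all _ fun t => by positivity),
      integral_div, integral_exp_mul_Ioi (by linarith)]
    simp
  have hci : IntegrableOn (fun x : ℝ => x⁻¹ / 2) (Set.Ioc (r ^ 2) (b ^ 2)) := by
    refine ContinuousOn.integrableOn_Icc ?_ |>.mono_set Set.Ioc_subset_Icc_self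
    refine ContinuousOn.div_const (continuousOn_inv₀.mono fun x hx => ?_) _
    exact ((by positivity : 0 < r ^ 2).trans_le hx.1).ne'
  rw [setLIntegral_congr_fun measurableSet_Ioc h2, ← ofReal_integral_eq_lintegral_ofReal hci
    ((ae_restrict_iff' measurableSet_Ioc).2 (ae_of_all _ fun x hx => by
      have : 0 < x := (by positivity : 0 < r ^ 2).trans hx.1
      simp only [Pi.zero_apply]
      positivity)),
    ← intervalIntegral.integral_of_le hrb, intervalIntegral.integral_div,
    integral_inv_of_pos (by positivity) (by positivity), ← div_pow, Real.log_pow,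
    Real.log_div hb0.ne' hr.ne']
  · push_cast
    congr 1
    ring

/-- The numerator is at most $1-e^{-tb^2}\le tb^2$, so the integrand is bounded by $b^2$. -/
lemma lintegral_exp_sub_exp_div_Ioc_le (r b ε : ℝ) :
    ∫⁻ t in Set.Ioc 0 ε,
      ENNReal.ofReal ((Real.exp (-t * r ^ 2) - Real.exp (-t * b ^ 2)) / (2 * t)) ≤
    ENNReal.ofReal (ε * b ^ 2) := by
  calc _ ≤ ∫⁻ t in Set.Ioc 0 ε, ENNReal.ofReal (b ^ 2) := by
        refine setLIntegral_mono' measurableSet_Ioc fun t ht => ENNReal.ofReal_le_ofReal ?_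
        have ht : 0 < t := ht.1
        rw [div_le_iff₀ (by positivity)]
        have h1 : Real.exp (-t * r ^ 2) ≤ 1 := Real.exp_le_one_iff.2 (by nlinarith [sq_nonneg r])
        have h2 := Real.add_one_le_exp (-t * b ^ 2)
        nlinarith [sq_nonneg b, mul_nonneg ht.le (sq_nonneg b)]
    _ = ENNReal.ofReal (ε * b ^ 2) := by
        rw [setLIntegral_const, Real.volume_Ioc, sub_zero, ← ENNReal.ofReal_mul (sq_nonneg b),
          mul_comm]

lemma gaussKernel_add {r b ε : ℝ} (hε : 0 < ε) (hr : 0 ≤ r) (hb : r ≤ b) :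
    gaussKernel ε r = gaussKernel ε b + ∫⁻ t in Set.Ioi ε,
      ENNReal.ofReal ((Real.exp (-t * r ^ 2) - Real.exp (-t * b ^ 2)) / (2 * t)) := by
  rw [gaussKernel, gaussKernel, ← lintegral_add_left (by fun_prop)]
  refine setLIntegral_congr_fun measurableSet_Ioi fun t ht => ?_
  have ht : 0 < t := hε.trans ht
  have h1 : r ^ 2 ≤ b ^ 2 := by gcongr
  rw [← ENNReal.ofReal_add (by positivity)]
  · congr 1
    ring
  · refine div_nonneg (sub_nonneg.2 (Real.exp_le_exp.2 ?_)) (by positivity)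
    nlinarith

/-- The Gaussian integral diverges at $t=0$, hence the cut at $\varepsilon$. Up to the finite
constant `gaussKernel ε b` the cut kernel is the part $t>\varepsilon$ of the Frullani integral; the
reverse bound `logKernel_add_gaussKernel_le` loses at most $\varepsilon b^2$. -/
lemma gaussKernel_le {b ε : ℝ} {z w : ℂ} (hε : 0 < ε) (hb : 0 < b) (hzw : ‖z - w‖ ≤ b) :
    gaussKernel ε ‖z - w‖ ≤ logKernel b z w + gaussKernel ε b := by
  rcases eq_or_ne z w with rfl | hne
  · simp [logKernel_self hb]
  have hr : 0 < ‖z - w‖ := norm_pos_iff.2 (sub_ne_zero.2 hne)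
  rw [gaussKernel_add hε hr.le hzw, add_comm, logKernel_of_ne hb hne,
    ← lintegral_exp_sub_exp_div hr hzw]
  gcongr

lemma logKernel_add_gaussKernel_le {b ε : ℝ} {z w : ℂ} (hε : 0 < ε) (hb : 0 < b)
    (hzw : ‖z - w‖ ≤ b) :
    logKernel b z w + gaussKernel ε b ≤ gaussKernel ε ‖z - w‖ + ENNReal.ofReal (ε * b ^ 2) := by
  rcases eq_or_ne z w with rfl | hne
  · simp [gaussKernel_zero hε]
  have hr : 0 < ‖z - w‖ := norm_pos_iff.2 (sub_ne_zero.2 hne)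
  rw [gaussKernel_add hε hr.le hzw, logKernel_of_ne hb hne, ← lintegral_exp_sub_exp_div hr hzw,
    ← Set.Ioc_union_Ioi_eq_Ioi hε.le, lintegral_union measurableSet_Ioi
      (Set.Ioc_disjoint_Ioi le_rfl)]
  have := lintegral_exp_sub_exp_div_Ioc_le ‖z - w‖ b ε
  calc _ ≤ (ENNReal.ofReal (ε * b ^ 2) + _) + gaussKernel ε b := by gcongr
    _ = _ := by ring

lemma lintegral_gaussKernel (ε : ℝ) (hε : 0 ≤ ε) (μ ν : Measure ℂ) [IsFiniteMeasure μ]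
    [IsFiniteMeasure ν] :
    ∫⁻ z, ∫⁻ w, gaussKernel ε ‖z - w‖ ∂ν ∂μ =
      ∫⁻ t in Set.Ioi ε, ENNReal.ofReal (gaussEnergy t μ ν / (2 * t)) := by
  simp only [gaussKernel]
  rw [← lintegral_prod (fun p : ℂ × ℂ => ∫⁻ t in Set.Ioi ε,
      ENNReal.ofReal (Real.exp (-t * ‖p.1 - p.2‖ ^ 2) / (2 * t))), lintegral_lintegral_swap]
  · refine setLIntegral_congr_fun measurableSet_Ioi fun t ht => ?_
    have ht : 0 < t := hε.trans_lt ht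
    rw [gaussEnergy, ← integral_div, ← ofReal_integral_eq_lintegral_ofReal]
    · refine (Integrable.of_bound (C := 1) (Continuous.aestronglyMeasurable (by fun_prop))
        (ae_of_all _ fun p => ?_)).div_const _
      rw [Real.norm_eq_abs, Real.abs_exp, Real.exp_le_one_iff]
      nlinarith [sq_nonneg ‖p.1 - p.2‖]
    · exact ae_of_all _ fun p => by positivity
  · fun_prop
  · exact (Measurable.lintegral_prod_right' (f := fun q : (ℂ × ℂ) × ℝ =>
      ENNReal.ofReal (Real.exp (-q.2 * ‖q.1.1 - q.1.2‖ ^ 2) / (2 * q.2))) (by fun_prop)).aemeasurable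

lemma measurable_gaussEnergy (μ ν : Measure ℂ) [IsFiniteMeasure μ] [IsFiniteMeasure ν] :
    Measurable fun t => gaussEnergy t μ ν := by
  refine StronglyMeasurable.measurable ?_
  exact StronglyMeasurable.integral_prod_right (f := fun (t : ℝ) (p : ℂ × ℂ) =>
    Real.exp (-t * ‖p.1 - p.2‖ ^ 2)) (Continuous.stronglyMeasurable (by fun_prop))

/-- The logarithmic energy is strictly positive definite on measures of finite energy. -/
theorem eq_of_logEnergy_add_le {b : ℝ} (hb : 0 < b) (μ ν : Measure ℂ) [IsProbabilityMeasure μ]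
    [IsProbabilityMeasure ν] {K : Set ℂ} (hK : ∀ z ∈ K, ∀ w ∈ K, ‖z - w‖ ≤ b)
    (hμ : μ Kᶜ = 0) (hν : ν Kᶜ = 0) (hμE : logEnergy b μ μ ≠ ⊤) (hνE : logEnergy b ν ν ≠ ⊤)
    (h : logEnergy b μ μ + logEnergy b ν ν ≤ 2 * logEnergy b μ ν) : μ = ν := by
  have key1 : ∀ ε > 0, ∀ α β : Measure ℂ, IsProbabilityMeasure α → IsProbabilityMeasure β →
      α Kᶜ = 0 → β Kᶜ = 0 →
      ∫⁻ z, ∫⁻ w, gaussKernel ε ‖z - w‖ ∂β ∂α ≤ logEnergy b α β + gaussKernel ε b := by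
    intro ε hε α β _ _ hα hβ
    calc _ ≤ ∫⁻ z, ∫⁻ w, (logKernel b z w + gaussKernel ε b) ∂β ∂α := by
          refine lintegral_mono_ae ?_
          filter_upwards [compl_mem_ae_iff.2 hα] with z hz
          refine lintegral_mono_ae ?_
          filter_upwards [compl_mem_ae_iff.2 hβ] with w hw
          exact gaussKernel_le hε hb (hK z (by simpa using hz) w (by simpa using hw))
      _ = _ := by
          simp_rw [lintegral_add_right _ measurable_const, lintegral_const, measure_univ, mul_one]
          rfl
  have key2 : ∀ ε > 0, logEnergy b μ ν + gaussKernel ε b ≤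
      ∫⁻ z, ∫⁻ w, gaussKernel ε ‖z - w‖ ∂ν ∂μ + ENNReal.ofReal (ε * b ^ 2) := by
    intro ε hε
    calc logEnergy b μ ν + gaussKernel ε b
        = ∫⁻ z, ∫⁻ w, (logKernel b z w + gaussKernel ε b) ∂ν ∂μ := by
          simp_rw [lintegral_add_right _ measurable_const, lintegral_const, measure_univ, mul_one]
          rfl
      _ ≤ ∫⁻ z, ∫⁻ w, (gaussKernel ε ‖z - w‖ + ENNReal.ofReal (ε * b ^ 2)) ∂ν ∂μ := by
          refine lintegral_mono_ae ?_
          filter_upwards [compl_mem_ae_iff.2 hμ] with z hz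
          refine lintegral_mono_ae ?_
          filter_upwards [compl_mem_ae_iff.2 hν] with w hw
          exact logKernel_add_gaussKernel_le hε hb
            (hK z (by simpa using hz) w (by simpa using hw))
      _ = _ := by
          simp_rw [lintegral_add_right _ measurable_const, lintegral_const, measure_univ, mul_one]
  -- Here `d t` is the nonnegative Gaussian energy of $\mu-\nu$, and `D ε` its superposition over
  -- $t>\varepsilon$, a cut-off logarithmic energy of $\mu-\nu$.
  set d : ℝ → ℝ := fun t => gaussEnergy t μ μ + gaussEnergy t ν ν - 2 * gaussEnergy t μ ν with hd
  set D : ℝ → ℝ≥0∞ := fun ε => ∫⁻ t in Set.Ioi ε, ENNReal.ofReal (d t / (2 * t)) with hD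
  have hmg := measurable_gaussEnergy μ ν
  have hmm := measurable_gaussEnergy μ μ
  have hnn := measurable_gaussEnergy ν ν
  have hmd : Measurable d := by fun_prop
  have hge : ∀ t α β, 0 ≤ gaussEnergy t α β := fun t α β =>
    integral_nonneg fun p => (Real.exp_pos _).le
  have key3 : ∀ ε > 0, ∫⁻ z, ∫⁻ w, gaussKernel ε ‖z - w‖ ∂μ ∂μ +
      ∫⁻ z, ∫⁻ w, gaussKernel ε ‖z - w‖ ∂ν ∂ν =
      D ε + 2 * ∫⁻ z, ∫⁻ w, gaussKernel ε ‖z - w‖ ∂ν ∂μ := by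
    intro ε hε
    rw [lintegral_gaussKernel ε hε.le, lintegral_gaussKernel ε hε.le,
      lintegral_gaussKernel ε hε.le, ← lintegral_const_mul _ (by fun_prop), hD,
      ← lintegral_add_left (by fun_prop), ← lintegral_add_left (by fun_prop)]
    refine setLIntegral_congr_fun measurableSet_Ioi fun t ht => ?_
    have ht : 0 < t := hε.trans ht
    have h1 := two_mul_gaussEnergy_le ht.le μ ν
    have h2 : 0 ≤ d t := sub_nonneg.2 h1
    have h3 := hge t μ μ
    have h4 := hge t ν ν
    have h5 := hge t μ ν
    rw [← ENNReal.ofReal_add (by positivity) (by positivity),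
      ← ENNReal.ofReal_ofNat, ← ENNReal.ofReal_mul (by norm_num),
      ← ENNReal.ofReal_add (by positivity) (by positivity)]
    congr 1
    rw [hd]
    ring
  -- Both measures have mass one, so the two constants `gaussKernel ε b` on each side balance and
  -- only the error $2\varepsilon b^2$ remains. Finiteness of the mixed term follows from `key3`.
  have key4 : ∀ ε > 0, D ε ≤ ENNReal.ofReal (2 * ε * b ^ 2) := by
    intro ε hε
    have hC := gaussKernel_ne_top hε hb
    have h1 := key1 ε hε μ μ ‹_› ‹_› hμ hμ
    have h2 := key1 ε hε ν ν ‹_› ‹_› hν hν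
    have h3 := key2 ε hε
    have h4 := key3 ε hε
    have h5 : 2 * ENNReal.ofReal (ε * b ^ 2) = ENNReal.ofReal (2 * ε * b ^ 2) := by
      rw [← ENNReal.ofReal_ofNat, ← ENNReal.ofReal_mul (by norm_num), mul_assoc]
    generalize ∫⁻ z, ∫⁻ w, gaussKernel ε ‖z - w‖ ∂μ ∂μ = A at *
    generalize ∫⁻ z, ∫⁻ w, gaussKernel ε ‖z - w‖ ∂ν ∂ν = B at *
    generalize ∫⁻ z, ∫⁻ w, gaussKernel ε ‖z - w‖ ∂ν ∂μ = G at *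
    have hA : A ≠ ⊤ := ne_top_of_le_ne_top (ENNReal.add_ne_top.2 ⟨hμE, hC⟩) h1
    have hB : B ≠ ⊤ := ne_top_of_le_ne_top (ENNReal.add_ne_top.2 ⟨hνE, hC⟩) h2
    have hG : 2 * G ≠ ⊤ := by
      refine ne_top_of_le_ne_top (ENNReal.add_ne_top.2 ⟨hA, hB⟩) ?_
      rw [h4]
      exact le_add_self
    rw [← ENNReal.add_le_add_iff_right hG, ← h4, ← h5]
    calc A + B ≤ (logEnergy b μ μ + gaussKernel ε b) + (logEnergy b ν ν + gaussKernel ε b) :=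
          add_le_add h1 h2
      _ = (logEnergy b μ μ + logEnergy b ν ν) + 2 * gaussKernel ε b := by ring
      _ ≤ 2 * logEnergy b μ ν + 2 * gaussKernel ε b := by gcongr
      _ = 2 * (logEnergy b μ ν + gaussKernel ε b) := by ring
      _ ≤ 2 * (G + ENNReal.ofReal (ε * b ^ 2)) := by gcongr
      _ = _ := by ring
  -- `D` is antitone, so `D 1 ≤ D ε` for $\varepsilon<1$, and the bound tends to $0$. A single $t>1$
  -- with `d t ≤ 0` then suffices.
  have key5 : D 1 = 0 := by
    have hlim : Tendsto (fun ε : ℝ => ENNReal.ofReal (2 * ε * b ^ 2)) (𝓝[>] 0) (𝓝 0) := by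
      have : Tendsto (fun ε : ℝ => ENNReal.ofReal (2 * ε * b ^ 2)) (𝓝 0)
          (𝓝 (ENNReal.ofReal (2 * 0 * b ^ 2))) :=
        Continuous.tendsto (ENNReal.continuous_ofReal.comp (by fun_prop)) 0
      rw [mul_zero, zero_mul, ENNReal.ofReal_zero] at this
      exact this.mono_left nhdsWithin_le_nhds
    refine le_antisymm (ge_of_tendsto hlim ?_) zero_le
    filter_upwards [Ioo_mem_nhdsGT (zero_lt_one (α := ℝ))] with ε hε
    exact (lintegral_mono_set (Set.Ioi_subset_Ioi hε.2.le)).trans (key4 ε hε.1)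
  rw [hD, lintegral_eq_zero_iff (by fun_prop)] at key5
  have hne : (ae (volume.restrict (Set.Ioi (1 : ℝ)))).NeBot := by
    rw [ae_neBot, Ne, Measure.restrict_eq_zero, Real.volume_Ioi]
    simp
  obtain ⟨t, ht0, ht1⟩ := (key5.and (ae_restrict_mem measurableSet_Ioi)).exists
  have ht : (0 : ℝ) < t := zero_lt_one.trans ht1
  refine eq_of_gaussEnergy ht μ ν ?_
  have h1 : d t / (2 * t) ≤ 0 := ENNReal.ofReal_eq_zero.1 ht0
  rw [div_le_iff₀ (by positivity), zero_mul] at h1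
  exact sub_nonpos.1 h1

end

/-! ### Potentials off the support, and connectedness of the complement of $K$. -/

section

variable {K : Set ℂ} {μ ν : Measure ℂ}

lemma integrable_of_continuousOn {E : Type*} [NormedAddCommGroup E] [IsFiniteMeasure μ]
    (hK : IsCompact K) (hμ : μ Kᶜ = 0) {f : ℂ → E} (hf : ContinuousOn f K) : Integrable f μ := by
  have h : IntegrableOn f K μ := hf.integrableOn_compact hK
  rwa [IntegrableOn, Measure.restrict_eq_self_of_ae_mem (mem_ae_iff.2 hμ)] at h

lemma continuousOn_log_norm_sub {z : ℂ} (hz : z ∉ K) :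
    ContinuousOn (fun w => Real.log ‖z - w‖) K := by
  refine ContinuousOn.log (by fun_prop) fun w hw => ?_
  exact norm_ne_zero_iff.2 (sub_ne_zero.2 fun h => hz (h ▸ hw))

lemma integrable_log_norm_sub [IsFiniteMeasure μ] (hK : IsCompact K) (hμ : μ Kᶜ = 0) {z : ℂ}
    (hz : z ∉ K) : Integrable (fun w => Real.log ‖z - w‖) μ :=
  integrable_of_continuousOn hK hμ (continuousOn_log_norm_sub hz)

lemma realPotential_le [IsFiniteMeasure μ] (hK : IsCompact K) (hμ : μ Kᶜ = 0) {z : ℂ}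
    (hz : z ∉ K) {b : ℝ} (hzb : ∀ w ∈ K, ‖z - w‖ ≤ b) :
    realPotential μ z ≤ Real.log b * μ.real Set.univ := by
  have h : realPotential μ z ≤ ∫ _, Real.log b ∂μ := by
    refine integral_mono_ae (integrable_log_norm_sub hK hμ hz) (integrable_const _) ?_
    filter_upwards [mem_ae_iff.2 hμ] with w hw
    exact Real.log_le_log (norm_pos_iff.2 (sub_ne_zero.2 fun h => hz (h ▸ hw))) (hzb w hw)
  rwa [integral_const, smul_eq_mul, mul_comm] at h

/-- Off the support, the potential in terms of the logarithmic kernel is a real integral. -/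
lemma logPot_eq_ofReal [IsFiniteMeasure μ] (hK : IsCompact K) (hμ : μ Kᶜ = 0) {z : ℂ}
    (hz : z ∉ K) {b : ℝ} (hb : 0 < b) (hzb : ∀ w ∈ K, ‖z - w‖ ≤ b) :
    logPot b μ z = ENNReal.ofReal (Real.log b * μ.real Set.univ - realPotential μ z) := by
  have hi := integrable_log_norm_sub hK hμ hz
  have h1 : Real.log b * μ.real Set.univ - realPotential μ z =
      ∫ w, (Real.log b - Real.log ‖z - w‖) ∂μ := by
    rw [integral_sub (integrable_const _) hi, integral_const, smul_eq_mul, mul_comm]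
    rfl
  have hi' : Integrable (fun w => Real.log b - Real.log ‖z - w‖) μ := (integrable_const _).sub hi
  rw [h1, ofReal_integral_eq_lintegral_ofReal hi']
  · refine lintegral_congr_ae ?_
    filter_upwards [mem_ae_iff.2 hμ] with w hw
    exact logKernel_of_ne hb fun h => hz (h ▸ hw)
  · filter_upwards [mem_ae_iff.2 hμ] with w hw
    have : 0 < ‖z - w‖ := norm_pos_iff.2 (sub_ne_zero.2 fun h => hz (h ▸ hw))
    exact sub_nonneg.2 (Real.log_le_log this (hzb w hw))

lemma potential_eq_realPotential [IsFiniteMeasure μ] (hK : IsCompact K) (hμ : μ Kᶜ = 0) {z : ℂ}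
    (hz : z ∉ K) : potential μ z = realPotential μ z := by
  obtain ⟨b, hb, hzb⟩ : ∃ b : ℝ, 0 < b ∧ ∀ w ∈ K, ‖z - w‖ ≤ b := by
    obtain ⟨C, hC⟩ := hK.exists_bound_of_continuousOn (f := fun w => z - w) (by fun_prop)
    exact ⟨max C 1, by positivity, fun w hw => (hC w hw).trans (le_max_left _ _)⟩
  rw [potential_eq hb (mem_of_superset (mem_ae_iff.2 hμ) hzb), logPot_eq_ofReal hK hμ hz hb hzb,
    EReal.coe_ennreal_ofReal, max_eq_left (sub_nonneg.2 (realPotential_le hK hμ hz hzb)),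
    ← EReal.coe_sub, sub_sub_cancel]

/-- The potential is harmonic off a compact set carrying the measure. -/
lemma harmonicAt_realPotential [IsFiniteMeasure μ] (hK : IsCompact K) (hμ : μ Kᶜ = 0) {z : ℂ}
    (hz : z ∉ K) : InnerProductSpace.HarmonicAt (realPotential μ) z := by
  obtain ⟨r, hr, hrK⟩ := Metric.isOpen_iff.1 hK.isClosed.isOpen_compl z hz
  have hdist : ∀ w ∈ K, r ≤ ‖z - w‖ := by
    intro w hw
    by_contra h
    refine hrK (?_ : w ∈ Metric.ball z r) hw
    rwa [Metric.mem_ball, dist_comm, dist_eq_norm, ← not_le]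
  have hne : ∀ w ∈ K, z - w ≠ 0 := fun w hw h => by
    have := hdist w hw
    rw [h, norm_zero] at this
    linarith
  -- Dividing by $z-w$ keeps the quotient within distance $1$ of $1$, so one branch of the logarithm
  -- serves all $w\in K$. Integrating it gives a holomorphic function of $x$ with real part
  -- $p_\mu(x)-p_\mu(z)$.
  have hslit : ∀ x ∈ Metric.ball z (r / 2), ∀ w ∈ K, (x - w) / (z - w) ∈ Complex.slitPlane := by
    intro x hx w hw
    rw [show (x - w) / (z - w) = 1 + (x - z) / (z - w) by
      rw [eq_comm, ← sub_eq_zero]; field_simp [hne w hw]; ring]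
    refine Complex.mem_slitPlane_of_norm_lt_one ?_
    rw [norm_div, div_lt_one (norm_pos_iff.2 (hne w hw))]
    rw [Metric.mem_ball, dist_eq_norm] at hx
    linarith [hdist w hw]
  have hlow : ∀ x ∈ Metric.ball z (r / 2), ∀ w ∈ K, r / 2 ≤ ‖x - w‖ := by
    intro x hx w hw
    rw [Metric.mem_ball, dist_comm, dist_eq_norm] at hx
    have := norm_sub_le_norm_sub_add_norm_sub z x w
    linarith [hdist w hw]
  have hint : ∀ x ∈ Metric.ball z (r / 2),
      Integrable (fun w => Complex.log ((x - w) / (z - w))) μ := by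
    intro x hx
    refine integrable_of_continuousOn hK hμ (ContinuousOn.clog ?_ fun w hw => hslit x hx w hw)
    exact ContinuousOn.div (by fun_prop) (by fun_prop) hne
  have hF : DifferentiableOn ℂ (fun x => ∫ w, Complex.log ((x - w) / (z - w)) ∂μ)
      (Metric.ball z (r / 2)) := by
    intro x hx
    refine DifferentiableAt.differentiableWithinAt ?_
    refine (hasDerivAt_integral_of_dominated_loc_of_deriv_le (F' := fun x w => 1 / (x - w))
      (bound := fun _ => 2 / r) (Metric.isOpen_ball.mem_nhds hx) ?_ (hint x hx) ?_ ?_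
      (integrable_const _) ?_).2.differentiableAt
    · exact Eventually.of_forall fun x => Measurable.aestronglyMeasurable (by fun_prop)
    · exact Measurable.aestronglyMeasurable (by fun_prop)
    · filter_upwards [mem_ae_iff.2 hμ] with w hw y hy
      rw [norm_div, norm_one, one_div_le (by linarith [hlow y hy w hw]) (by positivity), one_div_div]
      exact hlow y hy w hw
    · filter_upwards [mem_ae_iff.2 hμ] with w hw y hy
      have h1 : HasDerivAt (fun y => (y - w) / (z - w)) (1 / (z - w)) y :=
        ((hasDerivAt_id y).sub_const w).div_const _
      refine (h1.clog (hslit y hy w hw)).congr_deriv ?_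
      have h2 := hne w hw
      have h3 : y - w ≠ 0 := fun h => by
        have := hlow y hy w hw
        rw [h, norm_zero] at this
        linarith
      field_simp
  have han : AnalyticAt ℂ (fun x => ∫ w, Complex.log ((x - w) / (z - w)) ∂μ +
      (realPotential μ z : ℂ)) z :=
    (hF.analyticAt (Metric.ball_mem_nhds z (by positivity))).add analyticAt_const
  refine (InnerProductSpace.harmonicAt_congr_nhds ?_).1 han.harmonicAt_re
  filter_upwards [Metric.ball_mem_nhds z (show 0 < r / 2 by positivity)] with x hx
  have hxK : x ∉ K := fun h => by
    have := hlow x hx x h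
    simp only [sub_self, norm_zero] at this
    linarith
  have hre : (∫ w, Complex.log ((x - w) / (z - w)) ∂μ).re =
      ∫ w, (Complex.log ((x - w) / (z - w))).re ∂μ := (integral_re (hint x hx)).symm
  have hire : Integrable (fun w => (Complex.log ((x - w) / (z - w))).re) μ := (hint x hx).re
  rw [Complex.add_re, Complex.ofReal_re, hre, realPotential, realPotential,
    ← integral_add hire (integrable_log_norm_sub hK hμ hz)]
  refine integral_congr_ae ?_
  filter_upwards [mem_ae_iff.2 hμ] with w hw
  rw [Complex.log_re, norm_div, Real.log_div, sub_add_cancel]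
  · exact norm_ne_zero_iff.2 (sub_ne_zero.2 fun h => hxK (h ▸ hw))
  · exact norm_ne_zero_iff.2 (hne w hw)

/-- A frontier point in $U$ would have an open component of its own meeting the given one, hence
equal to it, and would be interior. -/
lemma frontier_connectedComponentIn_disjoint {X : Type*} [TopologicalSpace X]
    [LocallyConnectedSpace X] {U : Set X} (hU : IsOpen U) (x : X) :
    Disjoint (frontier (connectedComponentIn U x)) U := by
  rw [Set.disjoint_left]
  intro y hy hyU
  have h1 := hU.connectedComponentIn (x := y)
  obtain ⟨v, hv1, hv2⟩ := mem_closure_iff.1 hy.1 _ h1 (mem_connectedComponentIn hyU)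
  have h2 : connectedComponentIn U x = connectedComponentIn U y :=
    (connectedComponentIn_eq hv2).trans (connectedComponentIn_eq hv1).symm
  refine hy.2 ?_
  rw [h2, h1.interior_eq]
  exact mem_connectedComponentIn hyU

lemma isPreconnected_setOf_lt_norm {R : ℝ} (hR : 0 ≤ R) : IsPreconnected {z : ℂ | R < ‖z‖} := by
  have h : {z : ℂ | R < ‖z‖} =
      (fun p : ℝ × ℝ => (p.1 : ℂ) * Complex.exp (p.2 * Complex.I)) '' (Set.Ioi R ×ˢ Set.univ) := by
    ext z
    constructor
    · intro hz
      exact ⟨(‖z‖, Complex.arg z), ⟨hz, trivial⟩, Complex.norm_mul_exp_arg_mul_I z⟩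
    · rintro ⟨p, ⟨hp, -⟩, rfl⟩
      have hp : R < p.1 := hp
      simpa [Complex.norm_exp_ofReal_mul_I, abs_of_pos (hR.trans_lt hp)] using hp
  rw [h]
  exact (isPreconnected_Ioi.prod isPreconnected_univ).image _ (by fun_prop)

/-- The complement of a polynomially convex compact set is connected. -/
lemma isPreconnected_compl_of_isPolynomiallyConvex (hK : IsCompact K)
    (hconv : IsPolynomiallyConvex K) : IsPreconnected Kᶜ := by
  obtain ⟨R, hR⟩ := hK.isBounded.subset_closedBall 0
  have hR' : ∀ w ∈ K, ‖w‖ ≤ max R 0 := fun w hw =>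
    (mem_closedBall_zero_iff.1 (hR hw)).trans (le_max_left _ _)
  have hext : {z : ℂ | max R 0 < ‖z‖} ⊆ Kᶜ := fun z hz hzK => not_lt.2 (hR' z hzK) hz
  -- A component missing the outer region is bounded with frontier in $K$, so the maximum modulus
  -- principle would put it in the polynomial hull.
  have hmeet : ∀ z ∈ Kᶜ, (connectedComponentIn Kᶜ z ∩ {z : ℂ | max R 0 < ‖z‖}).Nonempty := by
    intro z hz
    by_contra hcon
    rw [Set.not_nonempty_iff_eq_empty, ← Set.disjoint_iff_inter_eq_empty] at hcon
    have hbdd : Bornology.IsBounded (connectedComponentIn Kᶜ z) := by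
      refine (Metric.isBounded_closedBall (x := 0) (r := max R 0)).subset fun y hy => ?_
      exact mem_closedBall_zero_iff.2 (not_lt.1 (Set.disjoint_left.1 hcon hy))
    refine hz (hconv z fun p M hp => ?_)
    refine Complex.norm_le_of_forall_mem_frontier_norm_le hbdd
      (f := fun w => p.eval w) p.differentiable.diffContOnCl (fun w hw => hp w ?_)
      (subset_closure (mem_connectedComponentIn hz))
    exact not_not.1 (Set.disjoint_left.1
      (frontier_connectedComponentIn_disjoint hK.isClosed.isOpen_compl z) hw)
  have hRn : (0 : ℝ) ≤ max R 0 := le_max_right _ _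
  have hz0 : ((max R 0 + 1 : ℝ) : ℂ) ∈ {z : ℂ | max R 0 < ‖z‖} := by
    simp only [Set.mem_ofPred_eq, Complex.norm_real, Real.norm_eq_abs]
    rw [abs_of_pos (by positivity)]
    linarith
  refine isPreconnected_of_forall ((max R 0 + 1 : ℝ) : ℂ) fun z hz => ?_
  obtain ⟨y, hy1, hy2⟩ := hmeet z hz
  refine ⟨connectedComponentIn Kᶜ z ∪ {z : ℂ | max R 0 < ‖z‖},
    Set.union_subset (connectedComponentIn_subset _ _) hext, Or.inr hz0,
    Or.inl (mem_connectedComponentIn hz), ?_⟩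
  exact isPreconnected_connectedComponentIn.union y hy1 hy2 (isPreconnected_setOf_lt_norm hRn)

/-- Two potentials that agree near infinity agree on the connected complement of `K`. -/
lemma realPotential_eqOn_compl [IsFiniteMeasure μ] [IsFiniteMeasure ν] (hK : IsCompact K)
    (hconn : IsPreconnected Kᶜ) (hμ : μ Kᶜ = 0) (hν : ν Kᶜ = 0) {R : ℝ}
    (h : ∀ z : ℂ, R ≤ ‖z‖ → realPotential μ z = realPotential ν z) :
    Set.EqOn (realPotential μ) (realPotential ν) Kᶜ := by
  obtain ⟨R', hR'⟩ := hK.isBounded.subset_closedBall 0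
  set ρ := max (max R R') 0 + 1 with hρ
  have hρ0 : 0 < ρ := by positivity
  have hρR : R < ρ := by
    have := (le_max_left R R').trans (le_max_left (max R R') 0)
    linarith
  have hρR' : R' < ρ := by
    have := (le_max_right R R').trans (le_max_left (max R R') 0)
    linarith
  have hn : ‖(ρ : ℂ)‖ = ρ := by rw [Complex.norm_real, Real.norm_eq_abs, abs_of_pos hρ0]
  -- Harmonic functions are real analytic; the identity theorem starts at a point beyond both $K$
  -- and the radius $R$.
  refine AnalyticOnNhd.eqOn_of_preconnected_of_eventuallyEq (𝕜 := ℝ) (z₀ := (ρ : ℂ))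
    (fun z hz => HarmonicAt.analyticAt (harmonicAt_realPotential hK hμ hz))
    (fun z hz => HarmonicAt.analyticAt (harmonicAt_realPotential hK hν hz)) hconn ?_ ?_
  · intro hmem
    have := mem_closedBall_zero_iff.1 (hR' hmem)
    linarith
  · have : ∀ᶠ z : ℂ in 𝓝 (ρ : ℂ), R < ‖z‖ :=
      continuous_norm.continuousAt.eventually_const_lt (by simpa only [hn] using hρR)
    filter_upwards [this] with z hz using h z hz.le

end

/-! ### Minimum principle, variation of the energy, and Frostman's bound. -/

section

/-- Locally $u=\operatorname{Re}F$, and $|e^{-F}|=e^{-u}$ has a local maximum, so the maximum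
modulus principle applies. -/
lemma eventually_eq_of_isLocalMin {u : ℂ → ℝ} {z : ℂ} {s : Set ℂ} (hs : s ∈ 𝓝 z)
    (hu : InnerProductSpace.HarmonicOnNhd u s) (hz : IsLocalMin u z) : ∀ᶠ y in 𝓝 z, u y = u z := by
  obtain ⟨r, hr, hrs⟩ := Metric.mem_nhds_iff.1 hs
  obtain ⟨F, hF, hFu⟩ := InnerProductSpace.HarmonicOnNhd.exists_analyticOnNhd_ball_re_eq
    (hu.mono hrs)
  have hnorm : ∀ y ∈ Metric.ball z r, ‖Complex.exp (-F y)‖ = Real.exp (-u y) := by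
    intro y hy
    rw [Complex.norm_exp, Complex.neg_re]
    congr 2
    exact hFu hy
  have hball := Metric.ball_mem_nhds z hr
  have h := Complex.norm_eventually_eq_of_isLocalMax (f := fun y => Complex.exp (-F y)) (c := z) ?_ ?_
  · filter_upwards [h, hball] with y hy1 hy2
    rw [hnorm y hy2, hnorm z (Metric.mem_ball_self hr)] at hy1
    exact neg_injective (Real.exp_injective hy1)
  · filter_upwards [hball] with y hy
    exact (hF y hy).differentiableAt.neg.cexp
  · filter_upwards [hball, hz] with y hy1 hy2
    simp only [Function.comp]
    rw [hnorm y hy1, hnorm z (Metric.mem_ball_self hr)]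
    exact Real.exp_le_exp.2 (neg_le_neg hy2)

/-- The minimum principle for functions that are harmonic off a closed set. -/
lemma le_of_harmonic_of_eventually_le {S : Set ℂ} {u : ℂ → ℝ} {m : ℝ} (hS : IsClosed S)
    (hu : InnerProductSpace.HarmonicOnNhd u Sᶜ) (hbd : ∀ ζ ∈ S, ∀ᶠ z in 𝓝 ζ, z ∉ S → m ≤ u z)
    (hinf : ∀ᶠ z in cocompact ℂ, z ∉ S → m ≤ u z) {z : ℂ} (hz : z ∉ S) : m ≤ u z := by
  by_contra hcon
  rw [not_le] at hcon
  set U : Set ℂ := {y | y ∉ S ∧ u y < m} with hU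
  have hUopen : IsOpen U :=
    hu.continuousOn.isOpen_inter_preimage hS.isOpen_compl isOpen_Iio
  obtain ⟨T, hT, hTu⟩ := mem_cocompact.1 hinf
  have hUT : U ⊆ T := fun y hy => by
    by_contra h
    exact not_lt.2 (hTu h hy.1) hy.2
  have hcomp : IsCompact (closure U) := hT.closure_of_subset hUT
  have hclS : closure U ⊆ Sᶜ := by
    intro ζ hζ hζS
    obtain ⟨y, hy1, hy2⟩ := ((mem_closure_iff_frequently.1 hζ).and_eventually (hbd ζ hζS)).exists
    exact not_lt.2 (hy2 hy1.1) hy1.2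
  obtain ⟨z₁, hz₁, hmin⟩ := hcomp.exists_isMinOn ⟨z, subset_closure ⟨hz, hcon⟩⟩
    (hu.continuousOn.mono hclS)
  have hz₁m : u z₁ < m := (hmin (subset_closure ⟨hz, hcon⟩)).trans_lt hcon
  -- The minimum points form a closed set, open by the local principle since $u<m$ there puts them
  -- in $U$. Being nonempty, it would be all of $\mathbb C$, yet it lies in a compact set.
  set M : Set ℂ := {y | y ∈ closure U ∧ u y = u z₁} with hM
  have hMclosed : IsClosed M :=
    (hu.continuousOn.mono hclS).preimage_isClosed_of_isClosed isClosed_closure isClosed_singleton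
  have hMopen : IsOpen M := by
    rw [isOpen_iff_mem_nhds]
    rintro y ⟨hy1, hy2⟩
    have hyU : U ∈ 𝓝 y := hUopen.mem_nhds ⟨hclS hy1, hy2 ▸ hz₁m⟩
    have hlm : IsLocalMin u y := by
      filter_upwards [hyU] with x hx
      rw [hy2]
      exact hmin (subset_closure hx)
    filter_upwards [hyU, eventually_eq_of_isLocalMin hyU (hu.mono fun x hx => hx.1) hlm]
      with x hx1 hx2
    exact ⟨subset_closure hx1, hx2.trans hy2⟩
  have huniv : M = Set.univ :=
    (isClopen_iff.1 ⟨hMclosed, hMopen⟩).resolve_left (Set.Nonempty.ne_empty ⟨z₁, hz₁, rfl⟩)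
  refine noncompact_univ ℂ (hcomp.of_isClosed_subset isClosed_univ ?_)
  rw [← huniv]
  exact fun y hy => hy.1

variable {K : Set ℂ} {b : ℝ} {ω : Measure ℂ}

/-- The first variation of the energy at a minimal measure. -/
lemma logEnergy_le_of_minimal [IsProbabilityMeasure ω] (hω : ω Kᶜ = 0)
    (hmin : ∀ σ : Measure ℂ, IsProbabilityMeasure σ → σ Kᶜ = 0 →
      logEnergy b ω ω ≤ logEnergy b σ σ)
    (σ : Measure ℂ) [IsProbabilityMeasure σ] (hσ : σ Kᶜ = 0) (hσE : logEnergy b σ σ ≠ ⊤) :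
    logEnergy b ω ω ≤ logEnergy b σ ω := by
  by_contra hcon
  rw [not_le] at hcon
  have hωE : logEnergy b ω ω ≠ ⊤ := ne_top_of_le_ne_top hσE (hmin σ ‹_› hσ)
  have hxE : logEnergy b σ ω ≠ ⊤ := hcon.ne_top
  have hcon' : (logEnergy b σ ω).toReal < (logEnergy b ω ω).toReal :=
    (ENNReal.toReal_lt_toReal hxE hωE).2 hcon
  have key : ∀ t : ℝ, 0 ≤ t → t ≤ 1 → (logEnergy b ω ω).toReal ≤
      (1 - t) * (1 - t) * (logEnergy b ω ω).toReal + 2 * (t * (1 - t)) * (logEnergy b σ ω).toReal +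
        t * t * (logEnergy b σ σ).toReal := by
    intro t ht0 ht1
    have ht1' : 0 ≤ 1 - t := sub_nonneg.2 ht1
    have hp : IsProbabilityMeasure (ENNReal.ofReal (1 - t) • ω + ENNReal.ofReal t • σ) := by
      constructor
      simp only [Measure.add_apply, Measure.smul_apply, measure_univ, smul_eq_mul, mul_one]
      rw [← ENNReal.ofReal_add ht1' ht0]
      simp
    have h := hmin (ENNReal.ofReal (1 - t) • ω + ENNReal.ofReal t • σ) hp (by simp [hω, hσ])
    have hf1 : IsFiniteMeasure (ENNReal.ofReal (1 - t) • ω) :=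
      Measure.smul_finite _ ENNReal.ofReal_ne_top
    have hf2 : IsFiniteMeasure (ENNReal.ofReal t • σ) :=
      Measure.smul_finite _ ENNReal.ofReal_ne_top
    rw [logEnergy_add_left, logEnergy_add_right, logEnergy_add_right, logEnergy_smul_left,
      logEnergy_smul_left, logEnergy_smul_left, logEnergy_smul_left, logEnergy_smul_right,
      logEnergy_smul_right, logEnergy_smul_right, logEnergy_smul_right, logEnergy_comm b ω σ] at h
    have h1 := ENNReal.toReal_mono (by simp [ENNReal.mul_eq_top, hωE, hxE, hσE]) h
    rw [ENNReal.toReal_add, ENNReal.toReal_add, ENNReal.toReal_add] at h1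
    · simp only [ENNReal.toReal_mul, ENNReal.toReal_ofReal ht0, ENNReal.toReal_ofReal ht1'] at h1
      linarith
    all_goals simp [ENNReal.mul_eq_top, hωE, hxE, hσE]
  set e := (logEnergy b ω ω).toReal
  set x := (logEnergy b σ ω).toReal
  set y := (logEnergy b σ σ).toReal
  have hy : 0 ≤ y := ENNReal.toReal_nonneg
  have hx : 0 ≤ x := ENNReal.toReal_nonneg
  have hpos : 0 < e - x := sub_pos.2 hcon'
  have hd : 0 < e + y + 1 := by linarith
  -- Expanding the energy of $(1-t)\omega+t\sigma$ requires $t(e-2x+y)\ge2(e-x)$ for $0<t\le1$. At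
  -- this $t$ the left side is at most $t(e+y+1)=e-x$, a contradiction.
  have ht : 0 < (e - x) / (e + y + 1) := by positivity
  have hk := key ((e - x) / (e + y + 1)) ht.le (by rw [div_le_one hd]; linarith)
  set t := (e - x) / (e + y + 1) with htdef
  have htm : t * (e + y + 1) = e - x := div_mul_cancel₀ _ hd.ne'
  have h2 : 0 ≤ t * (t * (e - 2 * x + y) - 2 * (e - x)) := by nlinarith
  have h3 : t * (e - 2 * x + y) < 2 * (e - x) := by nlinarith
  nlinarith

/-- By the first variation,
$E(\sigma,\sigma)+E(\omega,\omega)\le2E(\omega,\omega)\le2E(\sigma,\omega)$, so strict positive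
definiteness applies. -/
lemma eq_of_logEnergy_le_of_minimal [IsProbabilityMeasure ω] (hb : 0 < b)
    (hKb : ∀ z ∈ K, ∀ w ∈ K, ‖z - w‖ ≤ b) (hω : ω Kᶜ = 0) (hωE : logEnergy b ω ω ≠ ⊤)
    (hmin : ∀ σ : Measure ℂ, IsProbabilityMeasure σ → σ Kᶜ = 0 →
      logEnergy b ω ω ≤ logEnergy b σ σ)
    (σ : Measure ℂ) [IsProbabilityMeasure σ] (hσ : σ Kᶜ = 0)
    (hle : logEnergy b σ σ ≤ logEnergy b ω ω) : σ = ω := by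
  have hσE := ne_top_of_le_ne_top hωE hle
  refine eq_of_logEnergy_add_le hb σ ω hKb hσ hω hσE hωE ?_
  have := logEnergy_le_of_minimal hω hmin σ hσ hσE
  calc logEnergy b σ σ + logEnergy b ω ω ≤ logEnergy b ω ω + logEnergy b ω ω := by gcongr
    _ = 2 * logEnergy b ω ω := (two_mul _).symm
    _ ≤ 2 * logEnergy b σ ω := by gcongr

/-- Testing the first variation on normalized restrictions of $\omega$ bounds the kernel potential
below almost everywhere by its mean, which forces equality. -/
lemma logPot_ae_eq_of_minimal [IsProbabilityMeasure ω] (hω : ω Kᶜ = 0)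
    (hωE : logEnergy b ω ω ≠ ⊤)
    (hmin : ∀ σ : Measure ℂ, IsProbabilityMeasure σ → σ Kᶜ = 0 →
      logEnergy b ω ω ≤ logEnergy b σ σ) :
    ∀ᵐ z ∂ω, logPot b ω z = logEnergy b ω ω := by
  have h1 : (fun _ => logEnergy b ω ω) ≤ᵐ[ω] logPot b ω := by
    refine ae_le_of_forall_setLIntegral_le_of_sigmaFinite measurable_const fun A hA _ => ?_
    rw [setLIntegral_const]
    rcases eq_or_ne (ω A) 0 with h0 | h0
    · simp [h0]
    have hAt : ω A ≠ ⊤ := measure_ne_top _ _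
    have hp : IsProbabilityMeasure ((ω A)⁻¹ • ω.restrict A) := by
      constructor
      simp [ENNReal.inv_mul_cancel h0 hAt]
    have hnull : ((ω A)⁻¹ • ω.restrict A) Kᶜ = 0 := by
      rw [Measure.smul_apply, Measure.restrict_apply' hA, measure_mono_null Set.inter_subset_left hω,
        smul_zero]
    have hle : logEnergy b (ω.restrict A) (ω.restrict A) ≤ logEnergy b ω ω :=
      (lintegral_mono fun z => lintegral_mono' Measure.restrict_le_self le_rfl).trans
        (lintegral_mono' Measure.restrict_le_self le_rfl)
    have hfin : logEnergy b ((ω A)⁻¹ • ω.restrict A) ((ω A)⁻¹ • ω.restrict A) ≠ ⊤ := by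
      rw [logEnergy_smul_left, logEnergy_smul_right]
      exact ENNReal.mul_ne_top (ENNReal.inv_ne_top.2 h0)
        (ENNReal.mul_ne_top (ENNReal.inv_ne_top.2 h0) (ne_top_of_le_ne_top hωE hle))
    have h := logEnergy_le_of_minimal hω hmin _ hnull hfin
    rw [logEnergy_smul_left] at h
    calc logEnergy b ω ω * ω A ≤ ((ω A)⁻¹ * logEnergy b (ω.restrict A) ω) * ω A := by gcongr
      _ = logEnergy b (ω.restrict A) ω := by
          rw [mul_comm, ← mul_assoc, ENNReal.mul_inv_cancel h0 hAt, one_mul]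
  have h2 := ae_eq_of_ae_le_of_lintegral_le h1 (by simpa using hωE)
    (measurable_logPot b ω).aemeasurable (by
      rw [lintegral_const, measure_univ, mul_one]
      rfl)
  exact h2.symm

/-- By lower semicontinuity the exceptional set is open; being null, it misses the support. -/
lemma logPot_le_of_mem_support [IsFiniteMeasure ω] {e : ℝ≥0∞}
    (h : ∀ᵐ z ∂ω, logPot b ω z ≤ e) {ζ : ℂ} (hζ : ζ ∈ ω.support) : logPot b ω ζ ≤ e := by
  by_contra hcon
  have hopen : IsOpen {z | e < logPot b ω z} := (lowerSemicontinuous_logPot b ω).isOpen_preimage e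
  have hpos := (Measure.mem_support_iff_forall ζ).1 hζ _ (hopen.mem_nhds (not_le.1 hcon))
  refine hpos.ne' ?_
  rw [ae_iff] at h
  simpa only [not_le] using h

lemma measure_singleton_eq_zero_of_logPot_ne_top (hb : 0 < b) {ζ : ℂ} (h : logPot b ω ζ ≠ ⊤) :
    ω {ζ} = 0 := by
  by_contra hne
  refine h (top_unique ?_)
  calc (⊤ : ℝ≥0∞) = logKernel b ζ ζ * ω {ζ} := by
        rw [logKernel_self hb, ENNReal.top_mul hne]
    _ = ∫⁻ w in {ζ}, logKernel b ζ w ∂ω := (lintegral_singleton _ _).symm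
    _ ≤ logPot b ω ζ := setLIntegral_le_lintegral _ _

/-- The continuity principle: an upper bound for the kernel potential on the compact support
carries over, up to `ε`, to a neighbourhood of it. -/
lemma eventually_logPot_le [IsFiniteMeasure ω] (hb : 0 < b) {S : Set ℂ} (hS : IsCompact S)
    (hωS : ω Sᶜ = 0) {e : ℝ≥0∞} (he : e ≠ ⊤) (h : ∀ ζ ∈ S, logPot b ω ζ ≤ e) {ζ₀ : ℂ}
    (hζ₀ : ζ₀ ∈ S) {ε : ℝ} (hε : 0 < ε) :
    ∀ᶠ z in 𝓝 ζ₀, logPot b ω z ≤ e + ENNReal.ofReal ε := by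
  set m := ω.real Set.univ with hm
  have hm0 : 0 ≤ m := measureReal_nonneg
  set s : ℝ := ε / 2 / (m + 1) with hs
  have hs0 : 0 < s := by positivity
  have hsm : s * m ≤ ε / 2 := by
    rw [hs, div_mul_eq_mul_div, div_le_iff₀ (by positivity)]
    nlinarith
  have hatom := measure_singleton_eq_zero_of_logPot_ne_top hb (ne_top_of_le_ne_top he (h ζ₀ hζ₀))
  -- A finite potential excludes an atom at $\zeta_0$, so some neighbourhood has mass below
  -- $\varepsilon/2$.
  obtain ⟨U, hU1, hU2, hU3⟩ := Set.exists_isOpen_lt_of_lt {ζ₀} (μ := ω)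
    (ENNReal.ofReal (ε / 2)) (by rw [hatom]; simpa using hε)
  obtain ⟨δ, hδ, hδU⟩ := Metric.isOpen_iff.1 hU2 ζ₀ (hU1 rfl)
  have hη : 0 < min (δ / 2) (s * (δ / 2)) := by positivity
  filter_upwards [Metric.ball_mem_nhds ζ₀ hη] with z hz
  -- Replacing $z$ by a nearest point $\zeta\in S$ at most doubles distances to $S$, costing at most
  -- $1$ on the small set $U$. Off $U$, $|z-w|\ge\delta/2$ while $|z-\zeta|\le s\delta/2$, so the
  -- cost is only $s$.
  obtain ⟨ζ, hζS, hζ⟩ := hS.exists_infDist_eq_dist ⟨ζ₀, hζ₀⟩ z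
  have hnear : ∀ w ∈ S, ‖z - ζ‖ ≤ ‖z - w‖ := by
    intro w hw
    rw [← dist_eq_norm, ← dist_eq_norm, ← hζ]
    exact Metric.infDist_le_dist_of_mem hw
  have hzη : ‖z - ζ₀‖ < min (δ / 2) (s * (δ / 2)) := by rwa [← dist_eq_norm]
  have hz1 := hzη.trans_le (min_le_left _ _)
  have hz2 := hzη.trans_le (min_le_right _ _)
  have hbound : ∀ w ∈ S, logKernel b z w ≤
      logKernel b ζ w + (ENNReal.ofReal s + U.indicator 1 w) := by
    intro w hw
    have htri : ‖ζ - w‖ ≤ ‖z - ζ‖ + ‖z - w‖ := by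
      rw [norm_sub_rev z ζ]
      exact norm_sub_le_norm_sub_add_norm_sub _ _ _
    by_cases hwU : w ∈ U
    · refine (logKernel_le_add hb zero_le_one (ζ := ζ) ?_).trans ?_
      · linarith [hnear w hw]
      · rw [Set.indicator_of_mem hwU, ENNReal.ofReal_one]
        gcongr
        exact le_add_self
    · refine (logKernel_le_add hb hs0.le (ζ := ζ) ?_).trans ?_
      · have hwδ : δ ≤ ‖ζ₀ - w‖ := by
          by_contra hlt
          refine hwU (hδU ?_)
          rw [Metric.mem_ball, dist_comm, dist_eq_norm]
          exact not_le.1 hlt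
        have h1 := norm_sub_le_norm_sub_add_norm_sub ζ₀ z w
        rw [norm_sub_rev ζ₀ z] at h1
        have h2 : δ / 2 ≤ ‖z - w‖ := by linarith
        have h3 := hnear ζ₀ hζ₀
        nlinarith
      · rw [Set.indicator_of_notMem hwU, add_zero]
  calc logPot b ω z ≤ ∫⁻ w, (logKernel b ζ w + (ENNReal.ofReal s + U.indicator 1 w)) ∂ω := by
        refine lintegral_mono_ae ?_
        filter_upwards [mem_ae_iff.2 hωS] with w hw using hbound w hw
    _ = logPot b ω ζ + (ENNReal.ofReal s * ω Set.univ + ω U) := by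
        rw [lintegral_add_left (measurable_logKernel_left b ζ),
          lintegral_add_left measurable_const, lintegral_const,
          lintegral_indicator_one hU2.measurableSet]
        rfl
    _ ≤ e + (ENNReal.ofReal (ε / 2) + ENNReal.ofReal (ε / 2)) := by
        gcongr
        · exact h ζ hζS
        · rw [← ofReal_measureReal, ← ENNReal.ofReal_mul hs0.le]
          exact ENNReal.ofReal_le_ofReal hsm
    _ = e + ENNReal.ofReal ε := by
        rw [← ENNReal.ofReal_add (by positivity) (by positivity), add_halves]

/-- Frostman's lower bound for the potential of a measure of minimal logarithmic energy. -/
theorem le_realPotential_of_minimal [IsProbabilityMeasure ω] (hb : 0 < b) (hK : IsCompact K)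
    (hKb : ∀ z ∈ K, ∀ w ∈ K, ‖z - w‖ < b) (hω : ω Kᶜ = 0) (hωE : logEnergy b ω ω ≠ ⊤)
    (hmin : ∀ σ : Measure ℂ, IsProbabilityMeasure σ → σ Kᶜ = 0 →
      logEnergy b ω ω ≤ logEnergy b σ σ) {z : ℂ} (hz : z ∉ K) :
    Real.log b - (logEnergy b ω ω).toReal ≤ realPotential ω z := by
  set S := ω.support with hSdef
  have hSK : S ⊆ K := Measure.support_subset_of_isClosed hK.isClosed (mem_ae_iff.2 hω)
  have hS : IsCompact S := hK.of_isClosed_subset Measure.isClosed_support hSK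
  have hωS : ω Sᶜ = 0 := Measure.measure_compl_support
  have hle : ∀ ζ ∈ S, logPot b ω ζ ≤ logEnergy b ω ω := fun ζ hζ =>
    logPot_le_of_mem_support ((logPot_ae_eq_of_minimal hω hωE hmin).mono fun _ h => h.le) hζ
  refine le_of_forall_pos_sub_le fun ε hε => ?_
  -- The minimum principle is used off the support of $\omega$, where the potential bound is
  -- available at every point: the continuity principle handles the boundary, and growth of
  -- $p_\omega$ handles infinity.
  refine le_of_harmonic_of_eventually_le hS.isClosed
    (fun y hy => harmonicAt_realPotential hS hωS hy) (fun ζ hζ => ?_) ?_ (fun h => hz (hSK h))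
  · have hnear : ∀ᶠ y in 𝓝 ζ, ∀ w ∈ S, ‖y - w‖ < b := by
      refine hS.eventually_forall_of_forall_eventually fun w hw => ?_
      exact (Continuous.continuousAt (by fun_prop)).eventually_lt_const (hKb ζ (hSK hζ) w (hSK hw))
    filter_upwards [eventually_logPot_le hb hS hωS hωE hle hζ hε, hnear] with y hy1 hy2 hyS
    rw [logPot_eq_ofReal hS hωS hyS hb fun w hw => (hy2 w hw).le, ← ENNReal.ofReal_toReal hωE,
      ← ENNReal.ofReal_add ENNReal.toReal_nonneg hε.le, ENNReal.ofReal_le_ofReal_iff (by positivity),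
      probReal_univ, mul_one] at hy1
    linarith
  · obtain ⟨ρ, hρ⟩ := hS.isBounded.subset_closedBall 0
    set m := Real.log b - (logEnergy b ω ω).toReal - ε
    filter_upwards [(tendsto_norm_cocompact_atTop (E := ℂ)).eventually_ge_atTop (ρ + Real.exp m)]
      with y hy hyS
    calc m = ∫ _, m ∂ω := by simp
      _ ≤ realPotential ω y := by
        refine integral_mono_ae (integrable_const _) (integrable_log_norm_sub hS hωS hyS) ?_
        filter_upwards [mem_ae_iff.2 hωS] with w hw
        have h1 := mem_closedBall_zero_iff.1 (hρ hw)
        have h2 := norm_sub_norm_le y w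
        have h3 : Real.exp m ≤ ‖y - w‖ := by linarith
        exact (Real.le_log_iff_exp_le ((Real.exp_pos m).trans_le h3)).2 h3

end

/-! ### Existence and characterization of the equilibrium measure. -/

section

/-- The integral is the supremum over $n$ of the integrals of the bounded continuous functions
$\min(k,n)$, each weakly continuous in the measure. -/
lemma lowerSemicontinuous_lintegral_probabilityMeasure {X : Type*} [TopologicalSpace X]
    [MeasurableSpace X] [OpensMeasurableSpace X] {k : X → ℝ≥0∞} (hk : Continuous k) :
    LowerSemicontinuous fun μ : ProbabilityMeasure X => ∫⁻ x, k x ∂(μ : Measure X) := by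
  have h1 : (fun μ : ProbabilityMeasure X => ∫⁻ x, k x ∂(μ : Measure X)) =
      fun μ : ProbabilityMeasure X => ⨆ n : ℕ, ∫⁻ x, min (k x) n ∂(μ : Measure X) := by
    ext μ
    rw [← lintegral_iSup]
    · refine lintegral_congr fun x => ?_
      rw [← inf_iSup_eq, ENNReal.iSup_natCast, inf_top_eq]
    · exact fun n => (hk.min continuous_const).measurable
    · exact fun n m hnm x => min_le_min le_rfl (by exact_mod_cast hnm)
  rw [h1]
  refine lowerSemicontinuous_iSup fun n => Continuous.lowerSemicontinuous ?_
  have hne : ∀ x, min (k x) n ≠ ⊤ := fun x =>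
    ne_top_of_le_ne_top (ENNReal.natCast_ne_top n) (min_le_right _ _)
  have hcont : Continuous fun x => (min (k x) n).toNNReal :=
    ENNReal.continuousOn_toNNReal.comp_continuous (hk.min continuous_const) hne
  have hle : ∀ x, (min (k x) n).toNNReal ≤ n := fun x =>
    (ENNReal.toNNReal_mono (ENNReal.natCast_ne_top n) (min_le_right _ _)).trans_eq
      (ENNReal.toNNReal_natCast n)
  let f : BoundedContinuousFunction X NNReal :=
    BoundedContinuousFunction.mkOfBound ⟨fun x => (min (k x) n).toNNReal, hcont⟩ n fun x y => by
      have h1 : ((min (k x) n).toNNReal : ℝ) ≤ n := by exact_mod_cast hle x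
      have h2 : ((min (k y) n).toNNReal : ℝ) ≤ n := by exact_mod_cast hle y
      rw [NNReal.dist_eq, abs_sub_le_iff]
      constructor
      · exact (sub_le_self _ (NNReal.coe_nonneg _)).trans h1
      · exact (sub_le_self _ (NNReal.coe_nonneg _)).trans h2
  have hf : ∀ x, min (k x) n = (f x : ℝ≥0∞) := fun x => (ENNReal.coe_toNNReal (hne x)).symm
  simp_rw [hf]
  rw [continuous_iff_continuousAt]
  intro μ
  exact (ProbabilityMeasure.tendsto_iff_forall_lintegral_tendsto.1 tendsto_id) f

variable {K : Set ℂ} {b : ℝ} {ω : Measure ℂ}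

/-- Existence of a measure of minimal logarithmic energy. -/
lemma exists_minimal_logEnergy (hK : IsCompact K) (hne : K.Nonempty) (b : ℝ) :
    ∃ ω : Measure ℂ, IsProbabilityMeasure ω ∧ ω Kᶜ = 0 ∧
      ∀ σ : Measure ℂ, IsProbabilityMeasure σ → σ Kᶜ = 0 →
        logEnergy b ω ω ≤ logEnergy b σ σ := by
  have : CompactSpace K := isCompact_iff_compactSpace.1 hK
  have : Nonempty K := hne.to_subtype
  -- The energy integrates the kernel against $\mu\times\mu$, which depends continuously on $\mu$.
  -- Probability measures on the compact space $K$ form a compact space, so a minimum is attained.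
  have hlsc : LowerSemicontinuous fun μ : ProbabilityMeasure K =>
      ∫⁻ p, logKernel b p.1 p.2 ∂((μ.prod μ : ProbabilityMeasure (K × K)) : Measure (K × K)) := by
    have hk : Continuous fun p : K × K => logKernel b p.1 p.2 :=
      Continuous.comp (g := fun q : ℂ × ℂ => logKernel b q.1 q.2) (continuous_logKernel b)
        (f := fun p : K × K => ((p.1 : ℂ), (p.2 : ℂ))) (by fun_prop)
    have hc : Continuous fun μ : ProbabilityMeasure K => μ.prod μ :=
      ProbabilityMeasure.continuous_prod.comp (continuous_id.prodMk continuous_id)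
    exact fun μ y hy => (hc.tendsto μ).eventually
      (lowerSemicontinuous_lintegral_probabilityMeasure hk (μ.prod μ) y hy)
  obtain ⟨μ, -, hμ⟩ := (hlsc.lowerSemicontinuousOn Set.univ).exists_isMinOn
    (⟨⟨Measure.dirac (Classical.arbitrary K), inferInstance⟩, trivial⟩ :
      (Set.univ : Set (ProbabilityMeasure K)).Nonempty) isCompact_univ
  have hval : Measurable (Subtype.val : K → ℂ) := measurable_subtype_coe
  have hE : ∀ ν : ProbabilityMeasure K,
      logEnergy b ((ν : Measure K).map Subtype.val) ((ν : Measure K).map Subtype.val) =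
      ∫⁻ p, logKernel b p.1 p.2 ∂((ν.prod ν : ProbabilityMeasure (K × K)) : Measure (K × K)) := by
    intro ν
    rw [logEnergy, lintegral_map (measurable_logPot b _) hval, ProbabilityMeasure.toMeasure_prod,
      lintegral_prod]
    · refine lintegral_congr fun z => ?_
      rw [logPot, lintegral_map (measurable_logKernel_left b _) hval]
    · exact (((continuous_logKernel b).comp
        (by fun_prop : Continuous fun p : K × K => ((p.1 : ℂ), (p.2 : ℂ)))).measurable).aemeasurable
  refine ⟨(μ : Measure K).map Subtype.val, Measure.isProbabilityMeasure_map hval.aemeasurable, ?_,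
    fun σ _ hσ => ?_⟩
  · rw [Measure.map_apply hval hK.measurableSet.compl]
    simp
  · have hcm : (σ.comap (Subtype.val : K → ℂ)).map Subtype.val = σ := by
      rw [map_comap_subtype_coe hK.measurableSet,
        Measure.restrict_eq_self_of_ae_mem (mem_ae_iff.2 hσ)]
    have hp : IsProbabilityMeasure (σ.comap (Subtype.val : K → ℂ)) := by
      constructor
      have h1 : (σ.comap (Subtype.val : K → ℂ)).map Subtype.val Set.univ = 1 := by
        rw [hcm, measure_univ]
      rwa [Measure.map_apply hval MeasurableSet.univ] at h1
    have h2 := hμ (Set.mem_univ (⟨σ.comap Subtype.val, hp⟩ : ProbabilityMeasure K))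
    have h3 : logEnergy b ((σ.comap (Subtype.val : K → ℂ)).map Subtype.val)
        ((σ.comap (Subtype.val : K → ℂ)).map Subtype.val) = _ := hE ⟨σ.comap Subtype.val, hp⟩
    rw [hcm] at h3
    rw [hE, h3]
    exact h2

lemma energy_eq_of_isProbabilityMeasure (hb : 0 < b) (hKb : ∀ z ∈ K, ∀ w ∈ K, ‖z - w‖ ≤ b)
    (σ : Measure ℂ) [IsProbabilityMeasure σ] (hσ : σ Kᶜ = 0) :
    energy σ = (Real.log b : EReal) - (logEnergy b σ σ : EReal) := by
  rw [energy_eq hb, probReal_univ, mul_one, mul_one]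
  filter_upwards [mem_ae_iff.2 hσ] with z hz
  filter_upwards [mem_ae_iff.2 hσ] with w hw using hKb z hz w hw

lemma exists_logEnergy_ne_top (hb : 0 < b) (hKb : ∀ z ∈ K, ∀ w ∈ K, ‖z - w‖ ≤ b)
    (hpol : ¬ IsPolar K) :
    ∃ σ : Measure ℂ, IsProbabilityMeasure σ ∧ σ Kᶜ = 0 ∧ logEnergy b σ σ ≠ ⊤ := by
  simp only [IsPolar, not_forall] at hpol
  obtain ⟨μ, _, hμ0, ⟨C, hC, hCK, hμC⟩, hE⟩ := hpol
  have hμK : μ Kᶜ = 0 := measure_mono_null (Set.compl_subset_compl.2 hCK) hμC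
  have hfin : logEnergy b μ μ ≠ ⊤ := by
    intro htop
    refine hE ?_
    rw [energy_eq hb, htop]
    · simp
    · filter_upwards [mem_ae_iff.2 hμK] with z hz
      filter_upwards [mem_ae_iff.2 hμK] with w hw using hKb z hz w hw
  have h0 : μ Set.univ ≠ 0 := by simpa using hμ0
  refine ⟨(μ Set.univ)⁻¹ • μ, ⟨?_⟩, ?_, ?_⟩
  · rw [Measure.smul_apply, smul_eq_mul, ENNReal.inv_mul_cancel h0 (measure_ne_top _ _)]
  · rw [Measure.smul_apply, hμK, smul_zero]
  · rw [logEnergy_smul_left, logEnergy_smul_right]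
    exact ENNReal.mul_ne_top (ENNReal.inv_ne_top.2 h0)
      (ENNReal.mul_ne_top (ENNReal.inv_ne_top.2 h0) hfin)

lemma IsEquilibriumMeasure.logEnergy_le (hb : 0 < b) (hKb : ∀ z ∈ K, ∀ w ∈ K, ‖z - w‖ ≤ b)
    (hω : IsEquilibriumMeasure K ω) (σ : Measure ℂ) [IsProbabilityMeasure σ] (hσ : σ Kᶜ = 0) :
    logEnergy b ω ω ≤ logEnergy b σ σ := by
  have := hω.prob
  have h := hω.maximal σ ‹_› hσ
  rw [energy_eq_of_isProbabilityMeasure hb hKb σ hσ,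
    energy_eq_of_isProbabilityMeasure hb hKb ω hω.supported] at h
  rcases eq_or_ne (logEnergy b σ σ) ⊤ with ht | ht
  · rw [ht]
    exact le_top
  have ht' : logEnergy b ω ω ≠ ⊤ := by
    intro hc
    rw [hc] at h
    lift logEnergy b σ σ to NNReal using ht with x
    have h1 : ((x : ℝ≥0∞) : EReal) = ((x : ℝ) : EReal) := rfl
    rw [h1, ← EReal.coe_sub, EReal.coe_ennreal_top, EReal.sub_top] at h
    exact EReal.coe_ne_bot _ (le_bot_iff.1 h)
  lift logEnergy b σ σ to NNReal using ht with x
  lift logEnergy b ω ω to NNReal using ht' with y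
  have h1 : ((x : ℝ≥0∞) : EReal) = ((x : ℝ) : EReal) := rfl
  have h2 : ((y : ℝ≥0∞) : EReal) = ((y : ℝ) : EReal) := rfl
  rw [h1, h2, ← EReal.coe_sub, ← EReal.coe_sub, EReal.coe_le_coe_iff] at h
  have : (y : ℝ) ≤ x := by linarith
  exact_mod_cast this

lemma IsEquilibriumMeasure.logEnergy_ne_top (hb : 0 < b) (hKb : ∀ z ∈ K, ∀ w ∈ K, ‖z - w‖ ≤ b)
    (hpol : ¬ IsPolar K) (hω : IsEquilibriumMeasure K ω) : logEnergy b ω ω ≠ ⊤ := by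
  obtain ⟨σ, _, hσ, hσE⟩ := exists_logEnergy_ne_top hb hKb hpol
  exact ne_top_of_le_ne_top hσE (hω.logEnergy_le hb hKb σ hσ)

/-- The bound is strict so that it persists when one point moves slightly off $K$. -/
lemma exists_pos_bound_norm_sub (hK : IsCompact K) :
    ∃ b : ℝ, 0 < b ∧ ∀ z ∈ K, ∀ w ∈ K, ‖z - w‖ < b := by
  obtain ⟨R, hR⟩ := hK.isBounded.subset_closedBall 0
  refine ⟨2 * max R 0 + 1, by positivity, fun z hz w hw => ?_⟩
  have h1 := mem_closedBall_zero_iff.1 (hR hz)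
  have h2 := mem_closedBall_zero_iff.1 (hR hw)
  have h3 := norm_sub_le z w
  have h4 := le_max_left R 0
  linarith

/-- A compact non-polar set has an equilibrium measure. -/
theorem isEquilibriumMeasure_equilibriumMeasure (hK : IsCompact K) (hpol : ¬ IsPolar K) :
    IsEquilibriumMeasure K (equilibriumMeasure K) := by
  obtain ⟨b, hb, hKb'⟩ := exists_pos_bound_norm_sub hK
  have hKb : ∀ z ∈ K, ∀ w ∈ K, ‖z - w‖ ≤ b := fun z hz w hw => (hKb' z hz w hw).le
  have hne : K.Nonempty := by
    rw [Set.nonempty_iff_ne_empty]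
    rintro rfl
    obtain ⟨σ, _, hσ, -⟩ := exists_logEnergy_ne_top hb hKb hpol
    simp at hσ
  obtain ⟨ω, hω, hωK, hmin⟩ := exists_minimal_logEnergy hK hne b
  have hex : ∃ ω : Measure ℂ, IsEquilibriumMeasure K ω := by
    refine ⟨ω, hω, hωK, fun σ _ hσ => ?_⟩
    rw [energy_eq_of_isProbabilityMeasure hb hKb σ hσ,
      energy_eq_of_isProbabilityMeasure hb hKb ω hωK]
    exact EReal.sub_le_sub le_rfl (by exact_mod_cast hmin σ ‹_› hσ)
  rw [equilibriumMeasure, dif_pos hex]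
  exact hex.choose_spec

/-- The Green function off `K`, as a difference of real numbers. -/
lemma greenFunction_eq (hK : IsCompact K) (hpol : ¬ IsPolar K) {z : ℂ} (hz : z ∉ K) :
    greenFunction K z =
      realPotential (equilibriumMeasure K) z - (energy (equilibriumMeasure K)).toReal := by
  have hω := isEquilibriumMeasure_equilibriumMeasure hK hpol
  have := hω.prob
  obtain ⟨b, hb, hKb'⟩ := exists_pos_bound_norm_sub hK
  have hKb : ∀ z ∈ K, ∀ w ∈ K, ‖z - w‖ ≤ b := fun z hz w hw => (hKb' z hz w hw).le
  have hE := hω.logEnergy_ne_top hb hKb hpol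
  rw [greenFunction, potential_eq_realPotential hK hω.supported hz,
    energy_eq_of_isProbabilityMeasure hb hKb _ hω.supported]
  lift logEnergy b (equilibriumMeasure K) (equilibriumMeasure K) to NNReal using hE with x
  have h1 : ((x : ℝ≥0∞) : EReal) = ((x : ℝ) : EReal) := rfl
  rw [h1, ← EReal.coe_sub, ← EReal.coe_sub, EReal.toReal_coe, EReal.toReal_coe]

/-- A probability measure on the boundary of `K` whose potential agrees near infinity with that
of the equilibrium measure is the equilibrium measure. -/
theorem eq_equilibriumMeasure_of_realPotential_eq (hK : IsCompact K) (hpol : ¬ IsPolar K)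
    (hconv : IsPolynomiallyConvex K) (σ : Measure ℂ) [IsProbabilityMeasure σ]
    (hσ : σ (frontier K)ᶜ = 0) {R : ℝ}
    (h : ∀ z : ℂ, R ≤ ‖z‖ → realPotential σ z = realPotential (equilibriumMeasure K) z) :
    σ = equilibriumMeasure K := by
  have hω := isEquilibriumMeasure_equilibriumMeasure hK hpol
  generalize equilibriumMeasure K = ω at *
  have := hω.prob
  obtain ⟨b, hb, hKb'⟩ := exists_pos_bound_norm_sub hK
  have hKb : ∀ z ∈ K, ∀ w ∈ K, ‖z - w‖ ≤ b := fun z hz w hw => (hKb' z hz w hw).le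
  have hE := hω.logEnergy_ne_top hb hKb hpol
  have hmin : ∀ σ : Measure ℂ, IsProbabilityMeasure σ → σ Kᶜ = 0 →
      logEnergy b ω ω ≤ logEnergy b σ σ := fun σ _ hσ => hω.logEnergy_le hb hKb σ hσ
  have hσK : σ Kᶜ = 0 :=
    measure_mono_null (Set.compl_subset_compl.2 hK.isClosed.frontier_subset) hσ
  have heq := realPotential_eqOn_compl hK (isPreconnected_compl_of_isPolynomiallyConvex hK hconv)
    hσK hω.supported h
  -- If this failed at $\zeta$, lower semicontinuity would make it fail at nearby points off $K$,
  -- where $p_\sigma=p_\omega$ and Frostman's bound holds.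
  have hV : ∀ ζ ∈ frontier K, logPot b σ ζ ≤ logEnergy b ω ω := by
    intro ζ hζ
    by_contra hcon
    have hζK : ζ ∈ K := hK.isClosed.frontier_subset hζ
    have hnear : ∀ᶠ y in 𝓝 ζ, ∀ w ∈ K, ‖y - w‖ < b := by
      refine hK.eventually_forall_of_forall_eventually fun w hw => ?_
      exact (Continuous.continuousAt (by fun_prop)).eventually_lt_const (hKb' ζ hζK w hw)
    rw [frontier_eq_closure_inter_closure] at hζ
    obtain ⟨z, hz, hz1, hz2⟩ := ((mem_closure_iff_frequently.1 hζ.2).and_eventually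
      ((lowerSemicontinuous_logPot b σ ζ _ (not_le.1 hcon)).and hnear)).exists
    refine not_le.2 hz1 ?_
    rw [logPot_eq_ofReal hK hσK hz hb fun w hw => (hz2 w hw).le, heq hz, probReal_univ, mul_one,
      ← ENNReal.ofReal_toReal hE]
    refine ENNReal.ofReal_le_ofReal ?_
    have := le_realPotential_of_minimal hb hK hKb' hω.supported hE hmin hz
    linarith
  refine eq_of_logEnergy_le_of_minimal hb hKb hω.supported hE hmin σ hσK ?_
  calc logEnergy b σ σ ≤ ∫⁻ _, logEnergy b ω ω ∂σ := by
        refine lintegral_mono_ae ?_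
        filter_upwards [mem_ae_iff.2 hσ] with ζ hζ using hV ζ hζ
    _ = logEnergy b ω ω := by rw [lintegral_const, measure_univ, mul_one]

end

/-! ### Sweeping measures to the boundary. -/

section

open CompactlySupported in
/-- A linear functional on `C(X, ℝ)` that is bounded by its value at `1` is integration against
a measure. -/
lemma exists_measure_of_le_norm {X : Type*} [TopologicalSpace X] [T2Space X] [CompactSpace X]
    [MeasurableSpace X] [BorelSpace X] (g : C(X, ℝ) →ₗ[ℝ] ℝ) (hg : ∀ f, g f ≤ g 1 * ‖f‖) :
    ∃ μ : Measure X, IsFiniteMeasure μ ∧ ∀ f : C(X, ℝ), ∫ x, f x ∂μ = g f := by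
  have hpos : ∀ f : C(X, ℝ), 0 ≤ f → 0 ≤ g f := by
    intro f hf
    -- For $f\ge0$ this function has norm at most $\|f\|$, so the norm bound forces positivity of
    -- $g$.
    have h1 := hg (‖f‖ • 1 - f)
    have h0 : 0 ≤ g 1 := by
      have := hg (-1)
      rw [map_neg, norm_neg] at this
      by_contra hneg
      rw [not_le] at hneg
      have h3 := hg 1
      rcases isEmpty_or_nonempty X with hX | hX
      · have : (1 : C(X, ℝ)) = 0 := by ext x; exact hX.elim x
        rw [this, map_zero] at hneg
        exact lt_irrefl _ hneg
      · rw [norm_one] at this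
        linarith
    have h2 : ‖‖f‖ • (1 : C(X, ℝ)) - f‖ ≤ ‖f‖ := by
      rw [ContinuousMap.norm_le _ (norm_nonneg _)]
      intro x
      have h3 := f.norm_coe_le_norm x
      have h4 : 0 ≤ f x := hf x
      rw [Real.norm_eq_abs, abs_le] at h3
      simp only [ContinuousMap.sub_apply, ContinuousMap.smul_apply, ContinuousMap.one_apply,
        smul_eq_mul, mul_one, Real.norm_eq_abs]
      rw [abs_le]
      constructor <;> linarith
    rw [map_sub, map_smul, smul_eq_mul] at h1
    nlinarith
  let Λ : C_c(X, ℝ) →ₚ[ℝ] ℝ :=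
  { toFun φ := g φ.toContinuousMap
    map_add' φ ψ := map_add g φ.toContinuousMap ψ.toContinuousMap
    map_smul' c φ := map_smul g c φ.toContinuousMap
    monotone' φ ψ h := by
      have := hpos (ψ.toContinuousMap - φ.toContinuousMap) fun x => sub_nonneg.2 (h x)
      rw [map_sub] at this
      exact sub_nonneg.1 this }
  refine ⟨RealRMK.rieszMeasure Λ, inferInstance, fun f => ?_⟩
  exact RealRMK.integral_rieszMeasure Λ ⟨f, HasCompactSupport.of_compactSpace _⟩

/-- Sweeping a measure: if the real parts of holomorphic functions obey a maximum principle with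
respect to `X`, then a measure can be swept to `X` without changing their integrals. -/
theorem exists_sweep {X C : Set ℂ} {ρ : ℝ} (hX : IsCompact X) (hXρ : X ⊆ Metric.ball 0 ρ)
    (hC : IsCompact C) (hCρ : C ⊆ Metric.ball 0 ρ) (τ : Measure ℂ) [IsFiniteMeasure τ]
    (hτ : τ Cᶜ = 0)
    (hmax : ∀ F : ℂ → ℂ, DifferentiableOn ℂ F (Metric.ball 0 ρ) → ∀ M : ℝ,
      (∀ x ∈ X, (F x).re ≤ M) → ∀ᵐ y ∂τ, (F y).re ≤ M) :
    ∃ τ' : Measure ℂ, IsFiniteMeasure τ' ∧ τ' Xᶜ = 0 ∧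
      ∀ F : ℂ → ℂ, DifferentiableOn ℂ F (Metric.ball 0 ρ) →
        ∫ w, (F w).re ∂τ' = ∫ w, (F w).re ∂τ := by
  have : CompactSpace X := isCompact_iff_compactSpace.1 hX
  have hint : ∀ F : ℂ → ℂ, DifferentiableOn ℂ F (Metric.ball 0 ρ) →
      Integrable (fun w => (F w).re) τ := fun F hF =>
    integrable_of_continuousOn hC hτ
      (Complex.continuous_re.comp_continuousOn (hF.continuousOn.mono hCρ))
  have hle : ∀ (F : ℂ → ℂ), DifferentiableOn ℂ F (Metric.ball 0 ρ) → ∀ M : ℝ,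
      (∀ x ∈ X, (F x).re ≤ M) → ∫ w, (F w).re ∂τ ≤ τ.real Set.univ * M := by
    intro F hF M hM
    refine (integral_mono_ae (hint F hF) (integrable_const M) (hmax F hF M hM)).trans_eq ?_
    rw [integral_const, smul_eq_mul]
  -- The maximum principle, applied to $\pm(F-G)$ with $M=0$, makes the functional well defined on
  -- restrictions to $X$.
  have huniq : ∀ F G : ℂ → ℂ, DifferentiableOn ℂ F (Metric.ball 0 ρ) →
      DifferentiableOn ℂ G (Metric.ball 0 ρ) → (∀ x ∈ X, (F x).re = (G x).re) →
      ∫ w, (F w).re ∂τ = ∫ w, (G w).re ∂τ := by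
    have key : ∀ F G : ℂ → ℂ, DifferentiableOn ℂ F (Metric.ball 0 ρ) →
        DifferentiableOn ℂ G (Metric.ball 0 ρ) → (∀ x ∈ X, (F x).re = (G x).re) →
        ∫ w, (F w).re ∂τ ≤ ∫ w, (G w).re ∂τ := by
      intro F G hF hG h
      have h1 := hle (fun w => F w - G w) (hF.sub hG) 0 fun x hx => by
        rw [Complex.sub_re, h x hx, sub_self]
      simp only [Complex.sub_re] at h1
      rw [integral_sub (hint F hF) (hint G hG), mul_zero] at h1
      linarith
    exact fun F G hF hG h => le_antisymm (key F G hF hG h)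
      (key G F hG hF fun x hx => (h x hx).symm)
  let D : Submodule ℝ C(X, ℝ) :=
  { carrier := {f | ∃ F : ℂ → ℂ, DifferentiableOn ℂ F (Metric.ball 0 ρ) ∧ ∀ x : X, f x = (F x).re}
    add_mem' := by
      rintro f g ⟨F, hF, hf⟩ ⟨G, hG, hg⟩
      exact ⟨fun w => F w + G w, hF.add hG, fun x => by simp [hf, hg]⟩
    zero_mem' := ⟨fun _ => 0, differentiableOn_const 0, fun x => by simp⟩
    smul_mem' := by
      rintro c f ⟨F, hF, hf⟩
      exact ⟨fun w => (c : ℂ) * F w, hF.const_mul _, fun x => by simp [hf]⟩ }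
  have hD : ∀ f : D, ∃ F : ℂ → ℂ, DifferentiableOn ℂ F (Metric.ball 0 ρ) ∧
      ∀ x : X, (f : C(X, ℝ)) x = (F x).re := fun f => f.2
  choose Φ hΦ1 hΦ2 using hD
  let φ : C(X, ℝ) →ₗ.[ℝ] ℝ :=
  { domain := D
    toFun :=
    { toFun f := ∫ w, (Φ f w).re ∂τ
      map_add' := fun f g => by
        rw [← integral_add (hint _ (hΦ1 f)) (hint _ (hΦ1 g))]
        refine huniq _ (fun w => Φ f w + Φ g w) (hΦ1 _) ((hΦ1 f).add (hΦ1 g)) fun x hx => ?_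
        rw [Complex.add_re, ← hΦ2 f ⟨x, hx⟩, ← hΦ2 g ⟨x, hx⟩, ← hΦ2 (f + g) ⟨x, hx⟩]
        rfl
      map_smul' := fun c f => by
        rw [RingHom.id_apply, smul_eq_mul, ← integral_const_mul]
        have h1 : ∀ w, c * (Φ f w).re = ((c : ℂ) * Φ f w).re := fun w => by simp
        simp_rw [h1]
        refine huniq _ (fun w => (c : ℂ) * Φ f w) (hΦ1 _) ((hΦ1 f).const_mul _) fun x hx => ?_
        rw [← h1, ← hΦ2 f ⟨x, hx⟩, ← hΦ2 (c • f) ⟨x, hx⟩]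
        rfl } }
  have hφ : ∀ f : φ.domain, φ f = ∫ w, (Φ f w).re ∂τ := fun f => rfl
  -- Hahn–Banach. Constants belong to `D`, so `g 1` is the mass of $\tau$; the norm bound is then
  -- exactly what yields a representing measure.
  obtain ⟨g, hg1, hg2⟩ := exists_extension_of_le_sublinear φ (fun f => τ.real Set.univ * ‖f‖)
    (fun c hc f => by rw [norm_smul, Real.norm_eq_abs, abs_of_pos hc]; ring)
    (fun f g => by rw [← mul_add]; gcongr; exact norm_add_le f g)
    (fun f => by
      rw [hφ]
      refine hle _ (hΦ1 f) _ fun x hx => ?_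
      rw [← hΦ2 f ⟨x, hx⟩]
      exact (le_abs_self _).trans ((f : C(X, ℝ)).norm_coe_le_norm ⟨x, hx⟩))
  have hext : ∀ (F : ℂ → ℂ), DifferentiableOn ℂ F (Metric.ball 0 ρ) → ∀ f : C(X, ℝ),
      (∀ x : X, f x = (F x).re) → g f = ∫ w, (F w).re ∂τ := by
    intro F hF f hf
    have hfD : f ∈ D := ⟨F, hF, hf⟩
    refine (hg1 ⟨f, hfD⟩).trans (huniq _ _ (hΦ1 _) hF fun x hx => ?_)
    rw [← hf ⟨x, hx⟩, ← hΦ2 ⟨f, hfD⟩ ⟨x, hx⟩]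
  have hone : g 1 = τ.real Set.univ := by
    rw [hext (fun _ => 1) (differentiableOn_const 1) 1 fun x => by simp]
    simp
  obtain ⟨μ, hμ, hμg⟩ := exists_measure_of_le_norm g fun f => by
    rw [hone]
    exact hg2 f
  have hval : Measurable (Subtype.val : X → ℂ) := measurable_subtype_coe
  refine ⟨μ.map Subtype.val, inferInstance, ?_, fun F hF => ?_⟩
  · rw [Measure.map_apply hval hX.measurableSet.compl]
    simp
  · let f : C(X, ℝ) := ⟨fun x => (F x).re, by
      have := (Complex.continuous_re.comp_continuousOn (hF.continuousOn.mono hXρ)).domRestrict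
      exact this⟩
    rw [← hext F hF f fun x => rfl, ← hμg f]
    exact (MeasurableEmbedding.subtype_coe hX.measurableSet).integral_map _

/-- The maximum principle for the real part of a holomorphic function. -/
lemma re_le_of_forall_mem_frontier {U : Set ℂ} (hU : Bornology.IsBounded U) {D : Set ℂ}
    (hUD : closure U ⊆ D) {F : ℂ → ℂ} (hF : DifferentiableOn ℂ F D) {M : ℝ}
    (hM : ∀ x ∈ frontier U, (F x).re ≤ M) {z : ℂ} (hz : z ∈ closure U) : (F z).re ≤ M := by
  have h := Complex.norm_le_of_forall_mem_frontier_norm_le hU (f := fun w => Complex.exp (F w))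
    (DifferentiableOn.diffContOnCl (hF.mono hUD).cexp) (C := Real.exp M) (fun x hx => ?_) hz
  · rwa [Complex.norm_exp, Real.exp_le_exp] at h
  · rw [Complex.norm_exp, Real.exp_le_exp]
    exact hM x hx

/-- Measures with equal integrals of real parts of holomorphic functions have equal potentials
near infinity. -/
lemma realPotential_eq_of_integral_re_eq {μ ν : Measure ℂ} {C : Set ℂ} (hμ : μ Cᶜ = 0) (hν : ν Cᶜ = 0) {ρ : ℝ} (hρ : 0 < ρ)
    (hCρ : C ⊆ Metric.ball 0 ρ)
    (h : ∀ F : ℂ → ℂ, DifferentiableOn ℂ F (Metric.ball 0 ρ) →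
      ∫ w, (F w).re ∂μ = ∫ w, (F w).re ∂ν) {z : ℂ} (hz : ρ ≤ ‖z‖) :
    realPotential μ z = realPotential ν z := by
  have hz0 : z ≠ 0 := norm_pos_iff.1 (hρ.trans_le hz)
  -- For $|w|<\rho\le|z|$ the real part of this function is $\log|z-w|$, so the potential at $z$ is
  -- one of the preserved integrals.
  have hF : DifferentiableOn ℂ (fun w => Complex.log (1 + -(w / z)) + (Real.log ‖z‖ : ℂ))
      (Metric.ball 0 ρ) := by
    refine DifferentiableOn.add_const _ (DifferentiableOn.clog (by fun_prop) fun w hw => ?_)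
    refine Complex.mem_slitPlane_of_norm_lt_one ?_
    rw [norm_neg, norm_div, div_lt_one (norm_pos_iff.2 hz0)]
    exact (mem_ball_zero_iff.1 hw).trans_le hz
  have key : ∀ w ∈ Metric.ball (0 : ℂ) ρ, Real.log ‖z - w‖ =
      (Complex.log (1 + -(w / z)) + (Real.log ‖z‖ : ℂ)).re := by
    intro w hw
    have h1 : z - w = (1 + -(w / z)) * z := by field_simp; ring
    have h2 : z - w ≠ 0 := by
      rw [sub_ne_zero]
      rintro rfl
      exact not_lt.2 hz (mem_ball_zero_iff.1 hw)
    have h3 : 1 + -(w / z) ≠ 0 := fun h => h2 (by rw [h1, h, zero_mul])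
    rw [Complex.add_re, Complex.log_re, Complex.ofReal_re, h1, norm_mul,
      Real.log_mul (norm_ne_zero_iff.2 h3) (norm_ne_zero_iff.2 hz0)]
  have hint : ∀ α : Measure ℂ, α Cᶜ = 0 → realPotential α z =
      ∫ w, (Complex.log (1 + -(w / z)) + (Real.log ‖z‖ : ℂ)).re ∂α := fun α hα => by
    refine integral_congr_ae ?_
    filter_upwards [mem_ae_iff.2 hα] with w hw using key w (hCρ hw)
  rw [hint μ hμ, hint ν hν, h _ hF]

end

/-! ### No mass in the components of the interior. -/

section

variable {K : Set ℂ} {ω ν : Measure ℂ}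

/-- If no closure of a component of the interior of `K` is charged by the equilibrium measure,
then the equilibrium measure is the only probability measure on `K` with its potential near
infinity, and it is carried by the boundary. -/
theorem eq_equilibriumMeasure_of_components_null (hK : IsCompact K) (hpol : ¬ IsPolar K)
    (hconv : IsPolynomiallyConvex K)
    (hV : ∀ z ∈ interior K,
      equilibriumMeasure K (closure (connectedComponentIn (interior K) z)) = 0)
    (ν : Measure ℂ) [IsProbabilityMeasure ν] (hν : ν Kᶜ = 0) {R : ℝ}
    (h : ∀ z : ℂ, R ≤ ‖z‖ → realPotential ν z = realPotential (equilibriumMeasure K) z) :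
    ν = equilibriumMeasure K ∧ ν (frontier K)ᶜ = 0 := by
  obtain ⟨R', hR'⟩ := hK.isBounded.subset_closedBall 0
  obtain ⟨ρ, hρ, hKρ⟩ : ∃ ρ : ℝ, 0 < ρ ∧ K ⊆ Metric.ball 0 ρ := by
    refine ⟨max R' 0 + 1, by positivity, fun z hz => mem_ball_zero_iff.2 ?_⟩
    have h1 := mem_closedBall_zero_iff.1 (hR' hz)
    have h2 := le_max_left R' 0
    linarith
  have hfK : frontier K ⊆ K := hK.isClosed.frontier_subset
  have hcomp : ∀ z ∈ interior K, ν (connectedComponentIn (interior K) z) = 0 := by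
    intro z hz
    set V := connectedComponentIn (interior K) z with hVdef
    have hVo : IsOpen V := isOpen_interior.connectedComponentIn
    have hVK : V ⊆ K := (connectedComponentIn_subset _ _).trans interior_subset
    have hVcK : closure V ⊆ K := hK.isClosed.closure_subset_iff.2 hVK
    have hfV : frontier V ⊆ frontier K := by
      intro x hx
      rw [hK.isClosed.frontier_eq]
      exact ⟨hVcK (frontier_subset_closure hx),
        Set.disjoint_left.1 (frontier_connectedComponentIn_disjoint isOpen_interior z) hx⟩
    have hVb : Bornology.IsBounded V := hK.isBounded.subset hVK
    have hfVc : IsCompact (frontier V) :=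
      hK.of_isClosed_subset isClosed_frontier (hfV.trans hfK)
    obtain ⟨τ₁, _, hτ₁, hτ₁'⟩ := exists_sweep hfVc ((hfV.trans hfK).trans hKρ) hK hKρ
      (ν.restrict V) (by
        rw [Measure.restrict_apply' hVo.measurableSet]
        exact measure_mono_null Set.inter_subset_left hν) fun F hF M hM => by
      filter_upwards [ae_restrict_mem hVo.measurableSet] with y hy
      exact re_le_of_forall_mem_frontier hVb (hVcK.trans hKρ) hF hM (subset_closure hy)
    -- The remaining mass goes to $\partial K$: the maximum principle on the interior of $K$ covers
    -- interior points, and boundary points are covered directly.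
    obtain ⟨τ₂, _, hτ₂, hτ₂'⟩ := exists_sweep (hK.of_isClosed_subset isClosed_frontier hfK)
      (hfK.trans hKρ) hK hKρ (ν.restrict Vᶜ) (by
        rw [Measure.restrict_apply' hVo.measurableSet.compl]
        exact measure_mono_null Set.inter_subset_left hν) fun F hF M hM => by
      filter_upwards [ae_restrict_of_ae (mem_ae_iff.2 hν : K ∈ ae ν)] with y hy
      by_cases hyi : y ∈ interior K
      · exact re_le_of_forall_mem_frontier (hK.isBounded.subset interior_subset)
          ((hK.isClosed.closure_subset_iff.2 interior_subset).trans hKρ) hF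
          (fun x hx => hM x (frontier_interior_subset hx)) (subset_closure hyi)
      · exact hM y (by rw [hK.isClosed.frontier_eq]; exact ⟨hy, hyi⟩)
    have hτ₁f : τ₁ (frontier K)ᶜ = 0 := measure_mono_null (Set.compl_subset_compl.2 hfV) hτ₁
    have hτ₁K : τ₁ Kᶜ = 0 := measure_mono_null (Set.compl_subset_compl.2 hfK) hτ₁f
    have hτ₂K : τ₂ Kᶜ = 0 := measure_mono_null (Set.compl_subset_compl.2 hfK) hτ₂
    have hσK : (τ₁ + τ₂) Kᶜ = 0 := by rw [Measure.add_apply, hτ₁K, hτ₂K, add_zero]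
    have hint : ∀ F : ℂ → ℂ, DifferentiableOn ℂ F (Metric.ball 0 ρ) →
        ∫ w, (F w).re ∂(τ₁ + τ₂) = ∫ w, (F w).re ∂ν := by
      intro F hF
      have hcont : ContinuousOn (fun w => (F w).re) K :=
        Complex.continuous_re.comp_continuousOn (hF.continuousOn.mono hKρ)
      rw [integral_add_measure (integrable_of_continuousOn hK hτ₁K hcont)
        (integrable_of_continuousOn hK hτ₂K hcont), hτ₁' F hF, hτ₂' F hF]
      exact integral_add_compl hVo.measurableSet (integrable_of_continuousOn hK hν hcont)
    have hprob : IsProbabilityMeasure (τ₁ + τ₂) := by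
      have h1 := hint (fun _ => 1) (differentiableOn_const 1)
      rw [isProbabilityMeasure_iff_real]
      simpa using h1
    have hσ := eq_equilibriumMeasure_of_realPotential_eq hK hpol hconv (τ₁ + τ₂)
      (by rw [Measure.add_apply, hτ₁f, hτ₂, add_zero]) (R := max R ρ) fun y hy => by
      rw [realPotential_eq_of_integral_re_eq hσK hν hρ hKρ hint ((le_max_right _ _).trans hy),
        h y ((le_max_left _ _).trans hy)]
    -- The swept part of $\nu|_V$ is dominated by $\omega$ and carried by $\partial V$, so the
    -- hypothesis kills it. Sweeping preserves mass (take $F=1$), hence $\nu(V)=0$.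
    have h0 := hV z hz
    rw [← hσ, Measure.add_apply, add_eq_zero] at h0
    have h1 : τ₁ = 0 := by
      rw [← Measure.measure_univ_eq_zero, ← Set.union_compl_self (frontier V)]
      exact measure_union_null (measure_mono_null frontier_subset_closure h0.1) hτ₁
    have h2 := hτ₁' (fun _ => 1) (differentiableOn_const 1)
    rw [h1] at h2
    simp only [Complex.one_re, integral_const, smul_eq_mul, mul_one,
      measureReal_restrict_apply_univ] at h2
    exact (measureReal_eq_zero_iff).1 h2.symm
  have hintr : ν (interior K) = 0 := measure_null_of_locally_null _ fun x hx =>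
    ⟨connectedComponentIn (interior K) x, mem_nhdsWithin_of_mem_nhds
      (isOpen_interior.connectedComponentIn.mem_nhds (mem_connectedComponentIn hx)), hcomp x hx⟩
  have hfr : ν (frontier K)ᶜ = 0 := by
    refine measure_mono_null (fun x hx => ?_) (measure_union_null hν hintr)
    rw [hK.isClosed.frontier_eq] at hx
    by_cases hxK : x ∈ K
    · exact Or.inr (not_not.1 fun hxi => hx ⟨hxK, hxi⟩)
    · exact Or.inl hxK
  exact ⟨eq_equilibriumMeasure_of_realPotential_eq hK hpol hconv ν hfr h, hfr⟩

/-! ### Root distributions and their weak limits. -/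

lemma integrable_and_integral_sum_dirac (s : Multiset ℂ) (f : ℂ → ℝ) :
    Integrable f (s.map fun z => (Measure.dirac z : Measure ℂ)).sum ∧
      ∫ w, f w ∂(s.map fun z => (Measure.dirac z : Measure ℂ)).sum = (s.map f).sum := by
  induction s using Multiset.induction_on with
  | empty => simp
  | cons a s ih =>
    have ha : Integrable f (Measure.dirac a) := integrable_dirac (by simp)
    rw [Multiset.map_cons, Multiset.sum_cons, Multiset.map_cons, Multiset.sum_cons]
    exact ⟨ha.add_measure ih.1, by rw [integral_add_measure ha ih.1, ih.2, integral_dirac]⟩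

lemma sum_dirac_apply_eq_zero (s : Multiset ℂ) {T : Set ℂ} (hT : MeasurableSet T)
    (h : ∀ z ∈ s, z ∉ T) : (s.map fun z => (Measure.dirac z : Measure ℂ)).sum T = 0 := by
  induction s using Multiset.induction_on with
  | empty => simp
  | cons a s ih =>
    rw [Multiset.map_cons, Multiset.sum_cons, Measure.add_apply, Measure.dirac_apply' _ hT,
      Set.indicator_of_notMem (h a (Multiset.mem_cons_self a s)),
      ih fun z hz => h z (Multiset.mem_cons_of_mem hz), add_zero]

lemma integral_rootDistribution (q : ℂ[X]) (f : ℂ → ℝ) :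
    ∫ w, f w ∂(rootDistribution q) = (q.natDegree : ℝ)⁻¹ * (q.roots.map f).sum := by
  rw [rootDistribution, integral_smul_measure, (integrable_and_integral_sum_dirac _ f).2,
    smul_eq_mul, ENNReal.toReal_inv, ENNReal.toReal_natCast]

lemma isProbabilityMeasure_rootDistribution {q : ℂ[X]} (hq : 0 < q.natDegree) :
    IsProbabilityMeasure (rootDistribution q) := by
  rw [isProbabilityMeasure_iff_real]
  have h := integral_rootDistribution q fun _ => 1
  rw [integral_const, smul_eq_mul, mul_one] at h
  rw [h, Multiset.map_const', Multiset.sum_replicate, ← (IsAlgClosed.splits q).natDegree_eq_card_roots,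
    nsmul_eq_mul, mul_one]
  exact inv_mul_cancel₀ (by exact_mod_cast hq.ne')

lemma rootDistribution_compl_eq_zero {q : ℂ[X]} {T : Set ℂ} (hT : MeasurableSet T)
    (h : ∀ z, q.eval z = 0 → z ∈ T) : rootDistribution q Tᶜ = 0 := by
  rw [rootDistribution, Measure.smul_apply, sum_dirac_apply_eq_zero _ hT.compl, smul_zero]
  exact fun z hz hzT => hzT (h z (Polynomial.isRoot_of_mem_roots hz))

lemma log_norm_multiset_prod (s : Multiset ℂ) (h : (0 : ℂ) ∉ s) :
    Real.log ‖s.prod‖ = (s.map fun z => Real.log ‖z‖).sum := by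
  induction s using Multiset.induction_on with
  | empty => simp
  | cons a s ih =>
    rw [Multiset.mem_cons, not_or] at h
    rw [Multiset.prod_cons, norm_mul, Real.log_mul (norm_ne_zero_iff.2 (Ne.symm h.1))
      (norm_ne_zero_iff.2 (Multiset.prod_ne_zero h.2)), ih h.2, Multiset.map_cons,
      Multiset.sum_cons]

/-- The potential of the root distribution in terms of the polynomial. -/
lemma log_norm_eval_eq {q : ℂ[X]} (hq : q ≠ 0) {z : ℂ} (hz : q.eval z ≠ 0) :
    (1 / (q.natDegree : ℝ)) * Real.log ‖q.eval z‖ =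
      (1 / (q.natDegree : ℝ)) * Real.log ‖q.leadingCoeff‖ +
        realPotential (rootDistribution q) z := by
  have h0 : (0 : ℂ) ∉ q.roots.map (fun w => z - w) := by
    intro hmem
    obtain ⟨w, hw, hzw⟩ := Multiset.mem_map.1 hmem
    rw [sub_eq_zero] at hzw
    exact hz (hzw ▸ Polynomial.isRoot_of_mem_roots hw)
  rw [realPotential, integral_rootDistribution, (IsAlgClosed.splits q).eval_eq_prod_roots,
    norm_mul, Real.log_mul (norm_ne_zero_iff.2 (leadingCoeff_ne_zero.2 hq))
      (norm_ne_zero_iff.2 (Multiset.prod_ne_zero h0)), log_norm_multiset_prod _ h0,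
    Multiset.map_map, one_div, mul_add]
  rfl

/-- On the disc $|z-w|$ stays in $[1,|z|+\rho]$; clipping it to that range gives a bounded
continuous test function with the same integrals. -/
lemma tendsto_realPotential {ι : Type*} {l : Filter ι} {μ : ι → ProbabilityMeasure ℂ}
    {ν : ProbabilityMeasure ℂ} (hμν : Tendsto μ l (𝓝 ν)) {ρ : ℝ}
    (hμ : ∀ᶠ k in l, (μ k : Measure ℂ) (Metric.closedBall 0 ρ)ᶜ = 0)
    (hν : (ν : Measure ℂ) (Metric.closedBall 0 ρ)ᶜ = 0) {z : ℂ} (hz : ρ + 1 ≤ ‖z‖) :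
    Tendsto (fun k => realPotential (μ k) z) l (𝓝 (realPotential ν z)) := by
  set M : ℝ := max 1 (‖z‖ + ρ) with hM
  have hM1 : 1 ≤ M := le_max_left _ _
  have hlow : ∀ w : ℂ, 1 ≤ max 1 (min ‖z - w‖ M) := fun w => le_max_left _ _
  have hcont : Continuous fun w : ℂ => Real.log (max 1 (min ‖z - w‖ M)) :=
    Continuous.log (by fun_prop) fun w => (zero_lt_one.trans_le (hlow w)).ne'
  let f : BoundedContinuousFunction ℂ ℝ := BoundedContinuousFunction.ofNormedAddCommGroup
    (fun w => Real.log (max 1 (min ‖z - w‖ M))) hcont (Real.log M) fun w => by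
      rw [Real.norm_eq_abs, abs_of_nonneg (Real.log_nonneg (hlow w))]
      exact Real.log_le_log (zero_lt_one.trans_le (hlow w)) (max_le hM1 (min_le_right _ _))
  have hf : ∀ w ∈ Metric.closedBall (0 : ℂ) ρ, f w = Real.log ‖z - w‖ := by
    intro w hw
    rw [mem_closedBall_zero_iff] at hw
    have h1 : ‖z - w‖ ≤ M := (norm_sub_le z w).trans ((by linarith : _ ≤ _).trans (le_max_right _ _))
    have h2 : 1 ≤ ‖z - w‖ := by
      have := norm_sub_norm_le z w
      linarith
    change Real.log (max 1 (min ‖z - w‖ M)) = _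
    rw [min_eq_left h1, max_eq_right h2]
  have heq : ∀ α : Measure ℂ, α (Metric.closedBall 0 ρ)ᶜ = 0 →
      ∫ w, f w ∂α = realPotential α z := fun α hα => by
    refine integral_congr_ae ?_
    filter_upwards [mem_ae_iff.2 hα] with w hw using hf w hw
  have hlim := ProbabilityMeasure.tendsto_iff_forall_integral_tendsto.1 hμν f
  rw [heq ν hν] at hlim
  exact hlim.congr' (hμ.mono fun k hk => heq _ hk)

/-- Both potentials lie between $\log(|z|-\rho)$ and $\log(|z|+\rho)$. The decay at infinity is what
identifies an additive constant. -/
lemma abs_realPotential_sub_le [IsProbabilityMeasure ω] [IsProbabilityMeasure ν] {ρ : ℝ}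
    (hω : ω (Metric.closedBall 0 ρ)ᶜ = 0) (hν : ν (Metric.closedBall 0 ρ)ᶜ = 0) {z : ℂ}
    (hz : ρ < ‖z‖) (hρ : 0 ≤ ρ) :
    |realPotential ω z - realPotential ν z| ≤ 2 * ρ / (‖z‖ - ρ) := by
  have hpos : 0 < ‖z‖ - ρ := sub_pos.2 hz
  have hzB : z ∉ Metric.closedBall (0 : ℂ) ρ := fun h => not_lt.2 (mem_closedBall_zero_iff.1 h) hz
  have key : ∀ α : Measure ℂ, IsProbabilityMeasure α → α (Metric.closedBall 0 ρ)ᶜ = 0 →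
      Real.log (‖z‖ - ρ) ≤ realPotential α z ∧ realPotential α z ≤ Real.log (‖z‖ + ρ) := by
    intro α _ hα
    have hi := integrable_log_norm_sub (isCompact_closedBall (0 : ℂ) ρ) hα hzB
    have hb : ∀ w ∈ Metric.closedBall (0 : ℂ) ρ, ‖z‖ - ρ ≤ ‖z - w‖ ∧ ‖z - w‖ ≤ ‖z‖ + ρ := by
      intro w hw
      rw [mem_closedBall_zero_iff] at hw
      constructor
      · linarith [norm_sub_norm_le z w]
      · linarith [norm_sub_le z w]
    constructor
    · calc Real.log (‖z‖ - ρ) = ∫ _, Real.log (‖z‖ - ρ) ∂α := by simp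
        _ ≤ realPotential α z := by
          refine integral_mono_ae (integrable_const _) hi ?_
          filter_upwards [mem_ae_iff.2 hα] with w hw using Real.log_le_log hpos (hb w hw).1
    · calc realPotential α z ≤ ∫ _, Real.log (‖z‖ + ρ) ∂α := by
            refine integral_mono_ae hi (integrable_const _) ?_
            filter_upwards [mem_ae_iff.2 hα] with w hw
            exact Real.log_le_log (hpos.trans_le (hb w hw).1) (hb w hw).2
        _ = Real.log (‖z‖ + ρ) := by simp
  have hlog : Real.log (‖z‖ + ρ) - Real.log (‖z‖ - ρ) ≤ 2 * ρ / (‖z‖ - ρ) := by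
    rw [← Real.log_div (by linarith) hpos.ne']
    refine (Real.log_le_sub_one_of_pos (div_pos (by linarith) hpos)).trans_eq ?_
    field_simp
    ring
  obtain ⟨h1, h2⟩ := key ω ‹_› hω
  obtain ⟨h3, h4⟩ := key ν ‹_› hν
  rw [abs_le]
  constructor <;> linarith

/-- Portmanteau on small open balls whose closures still miss $K$, which is where weak centering
applies. -/
lemma measure_compl_eq_zero_of_weaklyCentersOn {q : ℕ → ℂ[X]} (hK : IsClosed K)
    (hcent : WeaklyCentersOn q K) {μ : ℕ → ProbabilityMeasure ℂ}
    (hμ : ∀ k, (μ k : Measure ℂ) = rootDistribution (q k)) {l : Filter ℕ} [l.NeBot]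
    (hl : l ≤ atTop) {ν : ProbabilityMeasure ℂ} (hν : Tendsto μ l (𝓝 ν)) :
    (ν : Measure ℂ) Kᶜ = 0 := by
  refine measure_null_of_locally_null _ fun x hx => ?_
  obtain ⟨r, hr, hrK⟩ := Metric.isOpen_iff.1 hK.isOpen_compl x hx
  refine ⟨Metric.ball x (r / 2),
    mem_nhdsWithin_of_mem_nhds (Metric.ball_mem_nhds x (by positivity)), ?_⟩
  have hdisj : Disjoint (Metric.closedBall x (r / 2)) K := by
    rw [Set.disjoint_left]
    exact fun y hy => hrK (Metric.closedBall_subset_ball (by linarith) hy)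
  have h1 := (hcent.2 _ Metric.isClosed_closedBall hdisj).mono_left hl
  have h2 : Tendsto (fun k => (μ k : Measure ℂ) (Metric.ball x (r / 2))) l (𝓝 0) := by
    refine tendsto_of_tendsto_of_tendsto_of_le_of_le tendsto_const_nhds h1 (fun k => zero_le)
      fun k => ?_
    simp only [hμ]
    exact measure_mono Metric.ball_subset_closedBall
  refine le_antisymm ?_ zero_le
  rw [← h2.liminf_eq]
  exact ProbabilityMeasure.le_liminf_measure_open_of_tendsto hν Metric.isOpen_ball

/-- Any limit of root distributions of a `K`-regular sequence has the potential of the equilibrium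
measure near infinity. -/
lemma exists_realPotential_eq_of_isKRegular {q : ℕ → ℂ[X]} (hK : IsCompact K) (hpol : ¬ IsPolar K)
    (hdeg : ∀ k, 0 < (q k).natDegree) (hreg : IsKRegular K q) (hcent : WeaklyCentersOn q K)
    {μ : ℕ → ProbabilityMeasure ℂ} (hμ : ∀ k, (μ k : Measure ℂ) = rootDistribution (q k))
    {l : Filter ℕ} [l.NeBot] (hl : l ≤ atTop) {ν : ProbabilityMeasure ℂ}
    (hν : Tendsto μ l (𝓝 ν)) :
    ∃ R : ℝ, ∀ z : ℂ, R ≤ ‖z‖ → realPotential ν z = realPotential (equilibriumMeasure K) z := by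
  have hω := isEquilibriumMeasure_equilibriumMeasure hK hpol
  have := hω.prob
  have hνK := measure_compl_eq_zero_of_weaklyCentersOn hK.isClosed hcent hμ hl hν
  obtain ⟨R₁, -, hlim⟩ := hreg
  obtain ⟨⟨N, R₂, hR₂, hroots⟩, -⟩ := hcent
  obtain ⟨R₃, hR₃⟩ := hK.isBounded.subset_closedBall 0
  set ρ := max R₂ R₃ with hρdef
  have hρ : 0 < ρ := hR₂.trans_le (le_max_left _ _)
  have hKρ : K ⊆ Metric.closedBall 0 ρ :=
    hR₃.trans (Metric.closedBall_subset_closedBall (le_max_right _ _))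
  have hωρ : equilibriumMeasure K (Metric.closedBall 0 ρ)ᶜ = 0 :=
    measure_mono_null (Set.compl_subset_compl.2 hKρ) hω.supported
  have hνρ : (ν : Measure ℂ) (Metric.closedBall 0 ρ)ᶜ = 0 :=
    measure_mono_null (Set.compl_subset_compl.2 hKρ) hνK
  have hN : ∀ᶠ k in l, N ≤ k := hl (eventually_ge_atTop N)
  have hμρ : ∀ᶠ k in l, (μ k : Measure ℂ) (Metric.closedBall 0 ρ)ᶜ = 0 := by
    filter_upwards [hN] with k hk
    rw [hμ]
    refine rootDistribution_compl_eq_zero Metric.isClosed_closedBall.measurableSet fun z hz => ?_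
    exact mem_closedBall_zero_iff.2 ((hroots k hk z hz).le.trans (le_max_left _ _))
  set I := (energy (equilibriumMeasure K)).toReal
  set R := max R₁ (ρ + 1) with hR
  -- The sequence on the left does not involve $z$, so its limit cannot either; this makes
  -- $p_\omega-p_\nu$ constant. Letting the comparison point go to infinity then shows that the
  -- constant is zero.
  have hconst : ∀ z : ℂ, R ≤ ‖z‖ →
      Tendsto (fun k => (1 / ((q k).natDegree : ℝ)) * Real.log ‖(q k).leadingCoeff‖) l
        (𝓝 (realPotential (equilibriumMeasure K) z - I - realPotential ν z)) := by
    intro z hz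
    have hzρ : ρ + 1 ≤ ‖z‖ := (le_max_right _ _).trans hz
    have hzK : z ∉ K := fun h => by
      have := mem_closedBall_zero_iff.1 (hKρ h)
      linarith
    have h1 := (hlim.tendsto_at ((le_max_left _ _).trans hz : z ∈ {z : ℂ | R₁ ≤ ‖z‖})).mono_left hl
    rw [greenFunction_eq hK hpol hzK] at h1
    refine (h1.sub (tendsto_realPotential hν hμρ hνρ hzρ)).congr' ?_
    filter_upwards [hN] with k hk
    have hne : (q k).eval z ≠ 0 := fun h => by
      have h2 := hroots k hk z h
      have h3 := le_max_left R₂ R₃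
      linarith
    rw [log_norm_eval_eq (ne_zero_of_natDegree_gt (hdeg k)) hne, hμ, add_sub_cancel_right]
  have hdiff : ∀ z z' : ℂ, R ≤ ‖z‖ → R ≤ ‖z'‖ →
      realPotential (equilibriumMeasure K) z - realPotential ν z =
        realPotential (equilibriumMeasure K) z' - realPotential ν z' := by
    intro z z' hz hz'
    have := tendsto_nhds_unique (hconst z hz) (hconst z' hz')
    linarith
  refine ⟨R, fun z hz => ?_⟩
  have hbound : ∀ x : ℝ, R ≤ x →
      |realPotential (equilibriumMeasure K) z - realPotential ν z| ≤ 2 * ρ / (x - ρ) := by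
    intro x hx
    have hρx : ρ < x := by
      have := le_max_right R₁ (ρ + 1)
      linarith
    have hn : ‖(x : ℂ)‖ = x := by
      rw [Complex.norm_real, Real.norm_eq_abs, abs_of_pos (hρ.trans hρx)]
    have h1 := abs_realPotential_sub_le (z := (x : ℂ)) hωρ hνρ (by rwa [hn]) hρ.le
    rw [hn] at h1
    rwa [hdiff z x hz (by rwa [hn])]
  have hzero : Tendsto (fun x : ℝ => 2 * ρ / (x - ρ)) atTop (𝓝 0) :=
    (tendsto_atTop_add_const_right atTop (-ρ) tendsto_id).const_div_atTop (2 * ρ)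
  have h0 := ge_of_tendsto hzero ((eventually_ge_atTop R).mono hbound)
  have h1 := abs_eq_zero.1 (le_antisymm h0 (abs_nonneg _))
  linarith

end

end

end PlanarPotential

/-! ### The main theorem. -/

open PlanarPotential
theorem mainTheorem5 (K : Set ℂ) (hK : IsCompact K) (hpol : ¬ IsPolar K)
    (hconv : IsPolynomiallyConvex K)
    (hV : ∀ z ∈ interior K,
      equilibriumMeasure K (closure (connectedComponentIn (interior K) z)) = 0)
    (q : ℕ → ℂ[X]) (hdeg : ∀ k, 0 < (q k).natDegree)
    (hlim : Tendsto (fun k => (q k).natDegree) atTop atTop)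
    (hreg : IsKRegular K q) (hcent : WeaklyCentersOn q K) :
    WeaklyCentersOn q (frontier K) ∧
      Tendsto (β := FiniteMeasure ℂ) (fun k => ⟨rootDistribution (q k), inferInstance⟩) atTop
        (𝓝 ⟨equilibriumMeasure K, inferInstance⟩) := by
  have hω := isEquilibriumMeasure_equilibriumMeasure hK hpol
  let μ : ℕ → ProbabilityMeasure ℂ := fun k =>
    ⟨rootDistribution (q k), isProbabilityMeasure_rootDistribution (hdeg k)⟩
  let ω : ProbabilityMeasure ℂ := ⟨equilibriumMeasure K, hω.prob⟩
  have hμ : ∀ k, (μ k : Measure ℂ) = rootDistribution (q k) := fun k => rfl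
  obtain ⟨⟨N, R, hR, hroots⟩, -⟩ := id hcent
  -- Prokhorov compactness for measures carried by one fixed disc; the index in the set is a dummy,
  -- with constant compact sets and tolerance $0$.
  have hcompact : IsCompact {σ : ProbabilityMeasure ℂ |
      ∀ _ : ℕ, σ (Metric.closedBall (0 : ℂ) R)ᶜ ≤ 0} :=
    isCompact_setOfPred_probabilityMeasure_mass_eq_compl_isCompact_le (u := fun _ => 0)
      tendsto_const_nhds (fun _ => isCompact_closedBall 0 R) (Or.inl inferInstance)
  have key : ∀ g : Ultrafilter ℕ, (g : Filter ℕ) ≤ atTop →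
      Tendsto μ g (𝓝 ω) ∧ (ω : Measure ℂ) (frontier K)ᶜ = 0 := by
    intro g hg
    have hmem : {σ : ProbabilityMeasure ℂ |
        ∀ _ : ℕ, σ (Metric.closedBall (0 : ℂ) R)ᶜ ≤ 0} ∈ g.map μ := by
      rw [Ultrafilter.mem_map]
      filter_upwards [hg (eventually_ge_atTop N)] with k hk _
      refine le_of_eq ((ProbabilityMeasure.null_iff_toMeasure_null _ _).2 ?_)
      exact rootDistribution_compl_eq_zero Metric.isClosed_closedBall.measurableSet fun z hz =>
        mem_closedBall_zero_iff.2 (hroots k hk z hz).le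
    obtain ⟨ν, -, hν⟩ := hcompact.ultrafilter_le_nhds _ (le_principal_iff.2 hmem)
    have hν' : Tendsto μ g (𝓝 ν) := hν
    obtain ⟨R', hR'⟩ := exists_realPotential_eq_of_isKRegular hK hpol hdeg hreg hcent hμ hg hν'
    obtain ⟨h1, h2⟩ := eq_equilibriumMeasure_of_components_null hK hpol hconv hV ν
      (measure_compl_eq_zero_of_weaklyCentersOn hK.isClosed hcent hμ hg hν') hR'
    have h3 : ν = ω := Subtype.ext h1
    exact ⟨h3 ▸ hν', h3 ▸ h2⟩
  have htend : Tendsto μ atTop (𝓝 ω) :=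
    (tendsto_iff_ultrafilter _ _ _).2 fun g hg => (key g hg).1
  have hfr : (ω : Measure ℂ) (frontier K)ᶜ = 0 :=
    (key (Ultrafilter.of atTop) (Ultrafilter.of_le atTop)).2
  refine ⟨⟨⟨N, R, hR, hroots⟩, fun L hL hdisj => ?_⟩, ?_⟩
  -- Portmanteau for closed sets: the upper limit is at most $\omega(L)$, which vanishes because
  -- $\omega$ lives on $\partial K$.
  · refine tendsto_of_le_liminf_of_limsup_le zero_le ?_
    refine (ProbabilityMeasure.limsup_measure_closed_le_of_tendsto htend hL).trans_eq ?_
    exact measure_mono_null (Set.disjoint_left.1 hdisj) hfr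
  · exact (ProbabilityMeasure.tendsto_nhds_iff_toFiniteMeasure_tendsto_nhds atTop).1 htend
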